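/- Let $\Omega\subset\mathbb R^{D}$ be a bounded connected open set with Lipschitz boundary, $\mathbf n$ the unit outward normal of $\partial\Omega$ (at every boundary point where it exists), and write $\langle\mathbf a,\mathbf b\rangle=\int_\Omega\mathbf a\cdot\mathbf b\,dV$, $\|\mathbf a\|^2=\langle\mathbf a,\mathbf a\rangle$, $\|\nabla\mathbf a\|^2=\sum_{i,j}\int_\Omega|\partial a_i/\partial x_j|^2dV$ and $I_{cv}(\mathbf a,\mathbf b)=\int_\Omega(\mathbf a\cdot\nabla\mathbf a)\cdot\mathbf b\,dV$. The Leray–Helmholtz projection $\mathbf u=\mathscr P\mathbf w$ with $\mathbf n\cdot\mathbf u=0$ on $\partial\Omega$ means $\mathbf u=\mathbf w-\nabla\phi$ for some scalar field $\phi\in C^2(\overline\Omega)$, with $\nabla\cdot\mathbf u=0$ in $\Omega$ and $\mathbf n\cdot\mathbf u=0$ on $\partial\Omega$. Let $\nu>0$ be the viscosity, $\lambda\ge0$ the penalty parameter, $k>0$ the time step, $t^n=t_0+nk$, $\mathbf g(\cdot,t)\in C^1(\overline\Omega)$ the body force, and $(A,\mathbf b,\mathbf c)$ an $s$-stage Runge–Kutta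 method with real coefficients. A solution of the GePUP-ES-RK scheme for the incompressible Navier–Stokes equations consists, for all $n\ge0$ and $1\le i\le s$, of fields $\mathbf w^n,\mathbf u^n,\mathbf u^{(i)}\in C^1(\overline\Omega)$, $\mathbf w^{(i)}\in C^3(\overline\Omega)$, $q^{(i)}\in C^2(\overline\Omega)$, $\widetilde{\mathbf u}^{(i)}\in C^2(\overline\Omega)$ and of scalars $r^n,r^{(i)}$ (the stage quantities depend on $n$; the auxiliary velocities $\widetilde{\mathbf u}^{(i)}$ are arbitrary) such that, with $\mathbf g^{(i)}=\mathbf g(\cdot,t^n+c_ik)$ and $$\boldsymbol\rho^{(i)}=\mathbf g^{(i)}-r^{(i)}\widetilde{\mathbf u}^{(i)}\cdot\nabla\widetilde{\mathbf u}^{(i)}-\nabla q^{(i)}+\nu\Delta\mathbf w^{(i)},$$ the following hold: - $\mathbf w^{n+1}=\mathbf w^n+k\sum_i b_i\boldsymbol\rho^{(i)}$ in $\Omega$, $\;r^{n+1}=r^n+k\sum_i b_iI_{cv}(\widetilde{\mathbf u}^{(i)},\mathbf u^{(i)})$, $\;\mathbf u^{n+1}=\mathscr P\mathbf w^{n+1}$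 with $\mathbf n\cdot\mathbf u^{n+1}=0$ on $\partial\Omega$; - $\Delta q^{(i)}=\nabla\cdot(\mathbf g^{(i)}-r^{(i)}\widetilde{\mathbf u}^{(i)}\cdot\nabla\widetilde{\mathbf u}^{(i)})$ in $\Omega$, and $\mathbf n\cdot\nabla q^{(i)}=\mathbf n\cdot(\mathbf g^{(i)}-r^{(i)}\widetilde{\mathbf u}^{(i)}\cdot\nabla\widetilde{\mathbf u}^{(i)}+\nu\Delta\mathbf w^{(i)})+\lambda\,\mathbf n\cdot\mathbf w^{(i)}$ on $\partial\Omega$; - $\mathbf w^{(i)}=\mathbf w^n+k\sum_j a_{i,j}\boldsymbol\rho^{(j)}$ in $\Omega$, and $\mathbf w^{(i)}\cdot\boldsymbol\tau=0$ for all tangent vectors $\boldsymbol\tau$, $\nabla\cdot\mathbf w^{(i)}=0$ on $\partial\Omega$; - $r^{(i)}=r^n+k\sum_j a_{i,j}I_{cv}(\widetilde{\mathbf u}^{(j)},\mathbf u^{(j)})$, and $\mathbf u^{(i)}=\mathscr P\mathbf w^{(i)}$ with $\mathbf n\cdot\mathbf u^{(i)}=0$ on $\partial\Omega$. Suppose that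 $\mathbf g$ is conservative ($\mathbf g(\cdot,t)=-\nabla\varphi_t$ in $\Omega$ with $\varphi_t\in C^1(\overline\Omega)$ for every $t$); that $\mathbf w^0=\mathbf u^0$ on $\overline\Omega$, where $\nabla\cdot\mathbf u^0=0$ in $\Omega$ and $\mathbf n\cdot\mathbf u^0=0$ on $\partial\Omega$; and that the Runge–Kutta method is algebraically stable, i.e. $b_i\ge0$ for all $i$ and the matrix with entries $m_{i,j}=b_ia_{i,j}+b_ja_{j,i}-b_ib_j$ is positive semidefinite. Then the modified energy $\mathcal E^n=\tfrac12(\|\mathbf u^n\|^2+|r^n|^2)$ satisfies, for every $n\ge0$, $$\mathcal E^{n+1}-\mathcal E^n\le-k\nu\sum_{i=1}^s b_i\|\nabla\mathbf u^{(i)}\|^2 .$$ -/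

import Mathlib

open Set Filter Topology MeasureTheory

namespace GePUP

noncomputable section

/-- The Euclidean space `ℝ^D`. -/
abbrev Eucl (D : ℕ) : Type := EuclideanSpace ℝ (Fin D)

/-! ### Domains and normals -/

/-- `n` is the unit outward normal of `∂Ω` at the boundary point `x`: the boundary has a tangent
hyperplane `n^⊥` at `x`, with `Ω` locally on the side of `-n`.  Precisely, outside of every
double cone of small aperture around the hyperplane, the points near `x` on the side of `-n`
belong to `Ω` and those on the side of `n` do not.  (At an edge or a corner there is none.) -/
def IsOutwardNormal {D : ℕ} (Ω : Set (Eucl D)) (x n : Eucl D) : Prop :=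
  x ∈ frontier Ω ∧ ‖n‖ = 1 ∧
    ∀ ε : ℝ, 0 < ε → ∀ᶠ y in 𝓝 x,
      (inner ℝ (y - x) n < -(ε * ‖y - x‖) → y ∈ Ω) ∧
      (ε * ‖y - x‖ < inner ℝ (y - x) n → y ∉ Ω)

/-- A bounded Lipschitz domain: a bounded connected open set which near each boundary point is,
in suitable Cartesian coordinates, the set below the graph of a Lipschitz function.  Here `e` is
the vertical direction, `y - ⟪y, e⟫ e` is the horizontal part of `y`, and only the values of `h`
on the hyperplane `e^⊥` matter. -/
structure IsLipschitzDomain {D : ℕ} (Ω : Set (Eucl D)) : Prop where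
  isOpen : IsOpen Ω
  isConnected : IsConnected Ω
  isBounded : Bornology.IsBounded Ω
  lipschitz_boundary : ∀ x ∈ frontier Ω,
    ∃ (e : Eucl D) (U : Set (Eucl D)) (K : NNReal) (h : Eucl D → ℝ),
      ‖e‖ = 1 ∧ IsOpen U ∧ x ∈ U ∧ LipschitzWith K h ∧
      ∀ y ∈ U, y ∈ Ω ↔ inner ℝ y e < h (y - (inner ℝ y e : ℝ) • e)

/-! ### Differential operators

All derivatives are taken within `closure Ω`; inside `Ω` these are the ordinary derivatives, and on
`∂Ω` they are their continuous extensions.  A field `f` is of class `C^m(closure Ω)` if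
`ContDiffOn ℝ m f (closure Ω)`. -/

/-- The gradient `∇φ` of a scalar field. -/
def grad {D : ℕ} (Ω : Set (Eucl D)) (φ : Eucl D → ℝ) (x : Eucl D) : Eucl D :=
  gradientWithin φ (closure Ω) x

/-- The partial derivative `∂v/∂x_j` of a vector field. -/
def partialDeriv {D : ℕ} (Ω : Set (Eucl D)) (j : Fin D) (v : Eucl D → Eucl D) (x : Eucl D) :
    Eucl D :=
  fderivWithin ℝ v (closure Ω) x (EuclideanSpace.single j 1)

/-- The divergence `∇ · v = ∑ i, ∂v_i/∂x_i`. -/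
def div {D : ℕ} (Ω : Set (Eucl D)) (v : Eucl D → Eucl D) (x : Eucl D) : ℝ :=
  ∑ i, partialDeriv Ω i v x i

/-- The Laplacian of a scalar field. -/
def lapl {D : ℕ} (Ω : Set (Eucl D)) (φ : Eucl D → ℝ) (x : Eucl D) : ℝ :=
  InnerProductSpace.laplacianWithin φ (closure Ω) x

/-- The (componentwise) Laplacian of a vector field. -/
def vecLapl {D : ℕ} (Ω : Set (Eucl D)) (v : Eucl D → Eucl D) (x : Eucl D) : Eucl D :=
  InnerProductSpace.laplacianWithin v (closure Ω) x

/-- The convection term `v · ∇v`, the derivative of `v` in the direction `v`. -/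
def conv {D : ℕ} (Ω : Set (Eucl D)) (v : Eucl D → Eucl D) (x : Eucl D) : Eucl D :=
  ∑ j, v x j • partialDeriv Ω j v x

/-! ### Integrals over `Ω` -/

/-- The `L²` inner product of vector fields over `Ω`. -/
def l2Inner {D : ℕ} (Ω : Set (Eucl D)) (u v : Eucl D → Eucl D) : ℝ :=
  ∫ x in Ω, inner ℝ (u x) (v x)

/-- The induced `L²` norm. -/
def l2Norm {D : ℕ} (Ω : Set (Eucl D)) (u : Eucl D → Eucl D) : ℝ :=
  Real.sqrt (l2Inner Ω u u)

/-- `‖∇u‖² = ∑ i, ∑ j, ∫_Ω |∂u_i/∂x_j|²`. -/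
def gradNormSq {D : ℕ} (Ω : Set (Eucl D)) (u : Eucl D → Eucl D) : ℝ :=
  ∑ i, ∑ j, ∫ x in Ω, |partialDeriv Ω j u x i| ^ 2

/-- `I_cv(u, v) = ∫_Ω (u · ∇u) · v`. -/
def Icv {D : ℕ} (Ω : Set (Eucl D)) (u v : Eucl D → Eucl D) : ℝ :=
  l2Inner Ω (conv Ω u) v

/-! ### Solenoidal fields and the Leray–Helmholtz projection -/

/-- `∇ · v = 0` in `Ω`. -/
def IsSolenoidal {D : ℕ} (Ω : Set (Eucl D)) (v : Eucl D → Eucl D) : Prop :=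
  ∀ x ∈ Ω, div Ω v x = 0

/-- `n · v = 0` on `∂Ω`. -/
def NoPenetration {D : ℕ} (Ω : Set (Eucl D)) (v : Eucl D → Eucl D) : Prop :=
  ∀ x n, IsOutwardNormal Ω x n → inner ℝ n (v x) = 0

/-- `u = 𝒫 v` with `n · u = 0` on `∂Ω`: the field `u` is the divergence-free part in the Helmholtz
decomposition `v = u + ∇φ` with zero normal component on the boundary. -/
def IsLerayProjection {D : ℕ} (Ω : Set (Eucl D)) (v u : Eucl D → Eucl D) : Prop :=
  (∃ φ : Eucl D → ℝ, ContDiffOn ℝ 2 φ (closure Ω) ∧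
    ∀ x ∈ closure Ω, u x = v x - grad Ω φ x) ∧
  IsSolenoidal Ω u ∧ NoPenetration Ω u

/-- The body force is conservative: at each time it is `-∇φ` for a scalar field `φ`. -/
def IsConservative {D : ℕ} (Ω : Set (Eucl D)) (g : ℝ → Eucl D → Eucl D) : Prop :=
  ∀ t, ∃ φ : Eucl D → ℝ, ContDiffOn ℝ 1 φ (closure Ω) ∧ ∀ x ∈ Ω, g t x = -grad Ω φ x

/-! ### Runge–Kutta methods -/

/-- The coefficients of an `s`-stage Runge–Kutta method. -/
structure RungeKutta (s : ℕ) where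
  A : Matrix (Fin s) (Fin s) ℝ
  b : Fin s → ℝ
  c : Fin s → ℝ

/-- The algebraic stability matrix `m_{ij} = b_i a_{ij} + b_j a_{ji} - b_i b_j`. -/
def RungeKutta.stabilityMatrix {s : ℕ} (M : RungeKutta s) : Matrix (Fin s) (Fin s) ℝ :=
  Matrix.of fun i j => M.b i * M.A i j + M.b j * M.A j i - M.b i * M.b j

/-- Algebraic stability. -/
def RungeKutta.AlgebraicallyStable {s : ℕ} (M : RungeKutta s) : Prop :=
  (∀ i, 0 ≤ M.b i) ∧ M.stabilityMatrix.PosSemidef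

/-! ### The semi-discrete scheme -/

/-- The parameters of a GePUP-ES-RK scheme: viscosity `ν`, penalty parameter `pen` (`λ`), time step
size `k`, initial time `t₀`, and body force `g`. -/
structure Params (D : ℕ) where
  ν : ℝ
  pen : ℝ
  k : ℝ
  t₀ : ℝ
  g : ℝ → Eucl D → Eucl D
  ν_pos : 0 < ν
  pen_nonneg : 0 ≤ pen
  k_pos : 0 < k

/-- The unknowns of a GePUP-ES-RK scheme.  `w n`, `u n`, `r n` are the values at the time `t^n`;
`ws n i`, `us n i`, `rs n i`, `qs n i` are the values `w^(i)`, `u^(i)`, `r^(i)`, `q^(i)` of the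
`i`-th stage of the step from `t^n` to `t^{n+1}`, and `ut n i` is the auxiliary velocity `ũ^(i)`. -/
structure Unknowns (D s : ℕ) where
  w : ℕ → Eucl D → Eucl D
  u : ℕ → Eucl D → Eucl D
  r : ℕ → ℝ
  ws : ℕ → Fin s → Eucl D → Eucl D
  us : ℕ → Fin s → Eucl D → Eucl D
  rs : ℕ → Fin s → ℝ
  qs : ℕ → Fin s → Eucl D → ℝ
  ut : ℕ → Fin s → Eucl D → Eucl D

/-- The body force `g^(i)` at the stage time `t^n + c_i k`, where `t^n = t₀ + n k`. -/
def stageForce {D s : ℕ} (P : Params D) (M : RungeKutta s) (n : ℕ) (i : Fin s) :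
    Eucl D → Eucl D :=
  P.g (P.t₀ + n * P.k + M.c i * P.k)

/-- The explicit part `g^(i) - r^(i) ũ^(i) · ∇ũ^(i)`. -/
def explicitPart {D s : ℕ} (Ω : Set (Eucl D)) (P : Params D) (M : RungeKutta s)
    (S : Unknowns D s) (n : ℕ) (i : Fin s) (x : Eucl D) : Eucl D :=
  stageForce P M n i x - S.rs n i • conv Ω (S.ut n i) x

/-- The stage slope `ρ^(i) = g^(i) - r^(i) ũ^(i) · ∇ũ^(i) - ∇q^(i) + ν Δw^(i)`. -/
def rho {D s : ℕ} (Ω : Set (Eucl D)) (P : Params D) (M : RungeKutta s)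
    (S : Unknowns D s) (n : ℕ) (i : Fin s) (x : Eucl D) : Eucl D :=
  explicitPart Ω P M S n i x - grad Ω (S.qs n i) x + P.ν • vecLapl Ω (S.ws n i) x

/-- `S` is a (classical) solution of the GePUP-ES-RK scheme on `Ω` with Runge–Kutta method `M`.
The auxiliary velocities `ũ^(i)` are arbitrary. -/
structure IsGePUPESRK {D s : ℕ} (Ω : Set (Eucl D)) (P : Params D) (M : RungeKutta s)
    (S : Unknowns D s) : Prop where
  -- Regularity up to the boundary.
  g_reg : ∀ t, ContDiffOn ℝ 1 (P.g t) (closure Ω)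
  w_reg : ∀ n, ContDiffOn ℝ 1 (S.w n) (closure Ω)
  u_reg : ∀ n, ContDiffOn ℝ 1 (S.u n) (closure Ω)
  ws_reg : ∀ n i, ContDiffOn ℝ 3 (S.ws n i) (closure Ω)
  us_reg : ∀ n i, ContDiffOn ℝ 1 (S.us n i) (closure Ω)
  qs_reg : ∀ n i, ContDiffOn ℝ 2 (S.qs n i) (closure Ω)
  ut_reg : ∀ n i, ContDiffOn ℝ 2 (S.ut n i) (closure Ω)
  -- The update from `t^n` to `t^{n+1}`.
  w_step : ∀ n, ∀ x ∈ Ω, S.w (n + 1) x = S.w n x + P.k • ∑ i, M.b i • rho Ω P M S n i x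
  r_step : ∀ n, S.r (n + 1) = S.r n + P.k * ∑ i, M.b i * Icv Ω (S.ut n i) (S.us n i)
  u_step : ∀ n, IsLerayProjection Ω (S.w (n + 1)) (S.u (n + 1))
  -- The stages; the projection contains the condition `n · u^(i) = 0` on `∂Ω`.
  q_eq : ∀ n i, ∀ x ∈ Ω, lapl Ω (S.qs n i) x = div Ω (explicitPart Ω P M S n i) x
  q_bdry : ∀ n i x nrm, IsOutwardNormal Ω x nrm →
    inner ℝ nrm (grad Ω (S.qs n i) x) =
      inner ℝ nrm (explicitPart Ω P M S n i x + P.ν • vecLapl Ω (S.ws n i) x)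
        + P.pen * inner ℝ nrm (S.ws n i x)
  ws_eq : ∀ n i, ∀ x ∈ Ω, S.ws n i x = S.w n x + P.k • ∑ j, M.A i j • rho Ω P M S n j x
  ws_tangential : ∀ n i x nrm, IsOutwardNormal Ω x nrm →
    ∀ τ : Eucl D, inner ℝ τ nrm = 0 → inner ℝ (S.ws n i x) τ = 0
  ws_div_bdry : ∀ n i, ∀ x ∈ frontier Ω, div Ω (S.ws n i) x = 0
  rs_eq : ∀ n i, S.rs n i = S.r n + P.k * ∑ j, M.A i j * Icv Ω (S.ut n j) (S.us n j)
  us_eq : ∀ n i, IsLerayProjection Ω (S.ws n i) (S.us n i)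

/-- The initial condition: `w^0 = u^0` on `closure Ω`, where the initial velocity `u^0` is
solenoidal and satisfies the no-penetration condition. -/
def InitialCondition {D s : ℕ} (Ω : Set (Eucl D)) (S : Unknowns D s) : Prop :=
  (∀ x ∈ closure Ω, S.w 0 x = S.u 0 x) ∧ IsSolenoidal Ω (S.u 0) ∧ NoPenetration Ω (S.u 0)

/-- The modified energy `½ (‖u^n‖² + |r^n|²)`. -/
def energy {D s : ℕ} (Ω : Set (Eucl D)) (S : Unknowns D s) (n : ℕ) : ℝ :=
  (1 / 2) * (l2Norm Ω (S.u n) ^ 2 + |S.r n| ^ 2)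

end

end GePUP

/-!
The point of the proof is that the unprojected velocity `w` is in fact already projected, so that
the scheme is an algebraically stable Runge–Kutta method for `w` and `r`, whose quadratic energy
can be computed stage by stage.

*Why `w` is projected.*  By the equation for `q`, the divergence of a stage slope is
`ν Δ (div w^(i))`, and `div w^(i)` vanishes on the boundary; by the boundary condition for `q`, the
normal component of a stage slope is `-λ n · w^(i)`.  So `div w` and `n · w` follow the Runge–Kutta
method for a dissipative linear equation with initial value zero, and algebraic stability
(`RungeKutta.AlgebraicallyStable.sq_le`) keeps them at zero.  The same inequality bounds the
weighted sum of the dissipations of the stages, hence `div w^(i) = 0` and `n · w^(i) = 0` at each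
stage with `b_i > 0` (`IsGePUPESRK.isSolenoidal_succ`, `IsGePUPESRK.noPenetration_succ`; if `λ = 0`,
the normal component is simply constant); stages with `b_i = 0` do not enter the energy inequality.
A field with these two properties is its own Leray
projection (`IsLerayProjection.eqOn`), so `u^n = w^n`, and `u^(i) = w^(i)` for these stages.

*The energy.*  Since the tangential components of `w^(i)` vanish too, `w^(i) = 0` at every boundary
point that has a normal, and the power `∫ w^(i) · ρ^(i)` is `-r^(i) I_cv - ν ‖∇u^(i)‖²`
(`IsGePUPESRK.integral_inner_ws_rho`).  Algebraic stability, applied pointwise to `w` and to the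
scalar `r`, yields the claim: the two convection contributions cancel.

*The divergence theorem.*  All integrations by parts reduce to `∫_Ω div F = 0` for a `C^1` field `F`
whose normal component vanishes wherever the normal exists
(`IsLipschitzDomain.integral_div_eq_zero`).  Near a boundary point `Ω` is `{0 < H}` with `H`
Lipschitz.  For the cutoffs `ψ_ε = η(H/ε - 1)`, integration by parts against Lipschitz functions
turns `∫ ψ_ε div F` into `-∫ ∇ψ_ε · F`.  At almost every point of the layer `ε ≤ H ≤ 2ε`, the
gradient of `H` exists by Rademacher's theorem and is normal to the boundary at the point vertically
above; there `F` is tangential, so `∇H · F` is small in the layer by uniform continuity of `F`,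
whereas the total weight of `∇ψ_ε` stays bounded.
-/

namespace GePUP

noncomputable section

variable {D : ℕ} {Ω : Set (Eucl D)}

/-! ### Partial derivatives of scalar fields -/

/-- The partial derivative `∂f/∂x_j` of a scalar field, taken within `closure Ω` like the
derivatives of vector fields. -/
def pd {D : ℕ} (Ω : Set (Eucl D)) (j : Fin D) (f : Eucl D → ℝ) (x : Eucl D) : ℝ :=
  fderivWithin ℝ f (closure Ω) x (EuclideanSpace.single j 1)

lemma closure_mem_nhds_of_mem (ho : IsOpen Ω) {x : Eucl D} (hx : x ∈ Ω) : closure Ω ∈ 𝓝 x :=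
  mem_of_superset (ho.mem_nhds hx) subset_closure

lemma pd_eq_fderiv (ho : IsOpen Ω) (j : Fin D) (f : Eucl D → ℝ) {x : Eucl D} (hx : x ∈ Ω) :
    pd Ω j f x = fderiv ℝ f x (EuclideanSpace.single j 1) := by
  rw [pd, fderivWithin_of_mem_nhds (closure_mem_nhds_of_mem ho hx)]

lemma pd_congr_of_eventuallyEq (ho : IsOpen Ω) (j : Fin D) {f g : Eucl D → ℝ} {x : Eucl D}
    (hx : x ∈ Ω) (h : f =ᶠ[𝓝 x] g) : pd Ω j f x = pd Ω j g x := by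
  rw [pd_eq_fderiv ho j f hx, pd_eq_fderiv ho j g hx, h.fderiv_eq]

lemma pd_congr (ho : IsOpen Ω) (j : Fin D) {f g : Eucl D → ℝ} (h : EqOn f g Ω) :
    EqOn (pd Ω j f) (pd Ω j g) Ω := fun _ hx =>
  pd_congr_of_eventuallyEq ho j hx (h.eventuallyEq_of_mem (ho.mem_nhds hx))

lemma contDiffOn_pd (hu : UniqueDiffOn ℝ (closure Ω)) {m n : WithTop ℕ∞} (j : Fin D)
    {f : Eucl D → ℝ} (hf : ContDiffOn ℝ n f (closure Ω)) (hmn : m + 1 ≤ n) :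
    ContDiffOn ℝ m (pd Ω j f) (closure Ω) :=
  (hf.fderivWithin hu hmn).clm_apply contDiffOn_const

lemma continuousOn_pd (hu : UniqueDiffOn ℝ (closure Ω)) (j : Fin D)
    {f : Eucl D → ℝ} (hf : ContDiffOn ℝ 1 f (closure Ω)) :
    ContinuousOn (pd Ω j f) (closure Ω) :=
  (contDiffOn_pd (m := 0) hu j hf (by simp)).continuousOn

lemma pd_add (hu : UniqueDiffOn ℝ (closure Ω)) (j : Fin D) {f g : Eucl D → ℝ}
    (hf : ContDiffOn ℝ 1 f (closure Ω)) (hg : ContDiffOn ℝ 1 g (closure Ω)) {x : Eucl D}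
    (hx : x ∈ closure Ω) : pd Ω j (fun y => f y + g y) x = pd Ω j f x + pd Ω j g x := by
  rw [pd, fderivWithin_fun_add (hu x hx) (hf.differentiableOn one_ne_zero x hx)
    (hg.differentiableOn one_ne_zero x hx)]
  rfl

lemma pd_sub (hu : UniqueDiffOn ℝ (closure Ω)) (j : Fin D) {f g : Eucl D → ℝ}
    (hf : ContDiffOn ℝ 1 f (closure Ω)) (hg : ContDiffOn ℝ 1 g (closure Ω)) {x : Eucl D}
    (hx : x ∈ closure Ω) : pd Ω j (fun y => f y - g y) x = pd Ω j f x - pd Ω j g x := by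
  rw [pd, fderivWithin_fun_sub (hu x hx) (hf.differentiableOn one_ne_zero x hx)
    (hg.differentiableOn one_ne_zero x hx)]
  rfl

lemma pd_mul (hu : UniqueDiffOn ℝ (closure Ω)) (j : Fin D) {f g : Eucl D → ℝ}
    (hf : ContDiffOn ℝ 1 f (closure Ω)) (hg : ContDiffOn ℝ 1 g (closure Ω)) {x : Eucl D}
    (hx : x ∈ closure Ω) :
    pd Ω j (fun y => f y * g y) x = f x * pd Ω j g x + g x * pd Ω j f x := by
  rw [pd, fderivWithin_fun_mul (hu x hx) (hf.differentiableOn one_ne_zero x hx)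
    (hg.differentiableOn one_ne_zero x hx)]
  rfl

lemma pd_const_mul (hu : UniqueDiffOn ℝ (closure Ω)) (j : Fin D) (c : ℝ) {f : Eucl D → ℝ}
    (hf : ContDiffOn ℝ 1 f (closure Ω)) {x : Eucl D} (hx : x ∈ closure Ω) :
    pd Ω j (fun y => c * f y) x = c * pd Ω j f x := by
  rw [pd, fderivWithin_const_mul (hu x hx) (hf.differentiableOn one_ne_zero x hx)]
  rfl

lemma pd_sum (hu : UniqueDiffOn ℝ (closure Ω)) (j : Fin D) {ι : Type*} (t : Finset ι)
    {f : ι → Eucl D → ℝ} (hf : ∀ i, ContDiffOn ℝ 1 (f i) (closure Ω)) {x : Eucl D}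
    (hx : x ∈ closure Ω) :
    pd Ω j (fun y => ∑ i ∈ t, f i y) x = ∑ i ∈ t, pd Ω j (f i) x := by
  rw [pd, fderivWithin_fun_sum (hu x hx)
    (fun i _ => (hf i).differentiableOn one_ne_zero x hx)]
  simp [pd]

/-- Symmetry of second derivatives. -/
lemma pd_comm (ho : IsOpen Ω) (i j : Fin D) {f : Eucl D → ℝ}
    (hf : ContDiffOn ℝ 2 f (closure Ω)) {x : Eucl D} (hx : x ∈ Ω) :
    pd Ω i (pd Ω j f) x = pd Ω j (pd Ω i f) x := by
  have hfx : ContDiffAt ℝ 2 f x := hf.contDiffAt (closure_mem_nhds_of_mem ho hx)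
  have hd : DifferentiableAt ℝ (fderiv ℝ f) x :=
    (hfx.fderiv_right (m := 1) (by norm_num)).differentiableAt one_ne_zero
  have key : ∀ k l : Fin D, pd Ω k (pd Ω l f) x =
      fderiv ℝ (fderiv ℝ f) x (EuclideanSpace.single k 1) (EuclideanSpace.single l 1) := by
    intro k l
    rw [pd_eq_fderiv ho k _ hx]
    have : pd Ω l f =ᶠ[𝓝 x] fun y => fderiv ℝ f y (EuclideanSpace.single l 1) := by
      filter_upwards [ho.mem_nhds hx] with y hy using pd_eq_fderiv ho l f hy
    rw [this.fderiv_eq, fderiv_clm_apply hd (differentiableAt_const _)]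
    simp
  rw [key, key]
  exact hfx.isSymmSndFDerivAt (by simp) _ _

/-! ### Vector fields in coordinates -/

lemma contDiffOn_coord {n : WithTop ℕ∞} {v : Eucl D → Eucl D} {s : Set (Eucl D)}
    (hv : ContDiffOn ℝ n v s) (i : Fin D) : ContDiffOn ℝ n (fun y => v y i) s :=
  contDiffOn_euclidean.1 hv i

lemma partialDeriv_apply (hu : UniqueDiffOn ℝ (closure Ω)) (i j : Fin D) {v : Eucl D → Eucl D}
    (hv : ContDiffOn ℝ 1 v (closure Ω)) {x : Eucl D} (hx : x ∈ closure Ω) :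
    partialDeriv Ω j v x i = pd Ω j (fun y => v y i) x := by
  have h := (EuclideanSpace.proj i : Eucl D →L[ℝ] ℝ).hasFDerivAt.comp_hasFDerivWithinAt x
    (hv.differentiableOn one_ne_zero x hx).hasFDerivWithinAt
  have h2 := h.fderivWithin (hu x hx)
  have h3 : (EuclideanSpace.proj i : Eucl D →L[ℝ] ℝ) ∘ v = fun y => v y i := rfl
  rw [pd, ← h3, h2]
  rfl

lemma div_eq_sum_pd (hu : UniqueDiffOn ℝ (closure Ω)) {v : Eucl D → Eucl D}
    (hv : ContDiffOn ℝ 1 v (closure Ω)) {x : Eucl D} (hx : x ∈ closure Ω) :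
    div Ω v x = ∑ i, pd Ω i (fun y => v y i) x :=
  Finset.sum_congr rfl fun i _ => partialDeriv_apply hu i i hv hx

lemma grad_apply (φ : Eucl D → ℝ) (x : Eucl D) (i : Fin D) : grad Ω φ x i = pd Ω i φ x := by
  have h : inner ℝ (grad Ω φ x) (EuclideanSpace.single i (1 : ℝ)) = pd Ω i φ x := by
    rw [grad, gradientWithin, InnerProductSpace.toDual_symm_apply, pd]
  rw [← h, EuclideanSpace.inner_single_right]
  simp

lemma contDiffOn_grad (hu : UniqueDiffOn ℝ (closure Ω)) {m n : WithTop ℕ∞} {φ : Eucl D → ℝ}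
    (hφ : ContDiffOn ℝ n φ (closure Ω)) (hmn : m + 1 ≤ n) :
    ContDiffOn ℝ m (grad Ω φ) (closure Ω) := by
  rw [contDiffOn_euclidean]
  intro i
  simp_rw [grad_apply]
  exact contDiffOn_pd hu i hφ hmn

lemma contDiffOn_partialDeriv (hu : UniqueDiffOn ℝ (closure Ω)) {m n : WithTop ℕ∞} (j : Fin D)
    {v : Eucl D → Eucl D} (hv : ContDiffOn ℝ n v (closure Ω)) (hmn : m + 1 ≤ n) :
    ContDiffOn ℝ m (partialDeriv Ω j v) (closure Ω) :=
  (hv.fderivWithin hu hmn).clm_apply contDiffOn_const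

lemma contDiffOn_div (hu : UniqueDiffOn ℝ (closure Ω)) {m n : WithTop ℕ∞}
    {v : Eucl D → Eucl D} (hv : ContDiffOn ℝ n v (closure Ω)) (hmn : m + 1 ≤ n) :
    ContDiffOn ℝ m (div Ω v) (closure Ω) :=
  ContDiffOn.sum fun i _ => contDiffOn_coord (contDiffOn_partialDeriv hu i hv hmn) i

lemma contDiffOn_conv (hu : UniqueDiffOn ℝ (closure Ω)) {m n : WithTop ℕ∞}
    {v : Eucl D → Eucl D} (hv : ContDiffOn ℝ n v (closure Ω)) (hmn : m + 1 ≤ n) :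
    ContDiffOn ℝ m (conv Ω v) (closure Ω) :=
  ContDiffOn.sum fun i _ => (contDiffOn_coord (hv.of_le (le_trans le_self_add hmn)) i).smul
    (contDiffOn_partialDeriv hu i hv hmn)

lemma laplacianWithin_eq_sum_fderivWithin (hu : UniqueDiffOn ℝ (closure Ω)) {V : Type*}
    [NormedAddCommGroup V] [NormedSpace ℝ V] {v : Eucl D → V}
    (hv : ContDiffOn ℝ 2 v (closure Ω)) {x : Eucl D} (hx : x ∈ closure Ω) :
    InnerProductSpace.laplacianWithin v (closure Ω) x = ∑ j : Fin D,
      fderivWithin ℝ (fun y => fderivWithin ℝ v (closure Ω) y (EuclideanSpace.single j 1))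
        (closure Ω) x (EuclideanSpace.single j 1) := by
  rw [InnerProductSpace.laplacianWithin_eq_iteratedFDerivWithin_orthonormalBasis v hu hx
    (EuclideanSpace.basisFun (Fin D) ℝ)]
  refine Finset.sum_congr rfl fun j _ => ?_
  rw [iteratedFDerivWithin_two_apply _ hu hx, fderivWithin_clm_apply (hu x hx)
    ((hv.fderivWithin (m := 1) hu (by norm_num)).differentiableOn one_ne_zero x hx)
    (differentiableWithinAt_const _)]
  simp

lemma lapl_eq_sum_pd (hu : UniqueDiffOn ℝ (closure Ω)) {φ : Eucl D → ℝ}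
    (hφ : ContDiffOn ℝ 2 φ (closure Ω)) {x : Eucl D} (hx : x ∈ closure Ω) :
    lapl Ω φ x = ∑ j, pd Ω j (pd Ω j φ) x :=
  laplacianWithin_eq_sum_fderivWithin hu hφ hx

lemma vecLapl_eq_sum_partialDeriv (hu : UniqueDiffOn ℝ (closure Ω)) {v : Eucl D → Eucl D}
    (hv : ContDiffOn ℝ 2 v (closure Ω)) {x : Eucl D} (hx : x ∈ closure Ω) :
    vecLapl Ω v x = ∑ j, partialDeriv Ω j (partialDeriv Ω j v) x :=
  laplacianWithin_eq_sum_fderivWithin hu hv hx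

lemma vecLapl_apply (hu : UniqueDiffOn ℝ (closure Ω)) {v : Eucl D → Eucl D}
    (hv : ContDiffOn ℝ 2 v (closure Ω)) {x : Eucl D} (hx : x ∈ closure Ω) (i : Fin D) :
    vecLapl Ω v x i = ∑ j, pd Ω j (pd Ω j (fun y => v y i)) x := by
  rw [vecLapl_eq_sum_partialDeriv hu hv hx, WithLp.ofLp_sum, Finset.sum_apply]
  refine Finset.sum_congr rfl fun j _ => ?_
  rw [partialDeriv_apply hu i j (contDiffOn_partialDeriv hu j hv (by norm_num)) hx, pd, pd]
  refine congrArg (fun L : Eucl D →L[ℝ] ℝ => L (EuclideanSpace.single j (1 : ℝ)))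
    (fderivWithin_congr ?_ ?_)
  · exact fun y hy => partialDeriv_apply hu i j (hv.of_le (by norm_num)) hy
  · exact partialDeriv_apply hu i j (hv.of_le (by norm_num)) hx

lemma contDiffOn_vecLapl (hu : UniqueDiffOn ℝ (closure Ω)) {m n : WithTop ℕ∞}
    {v : Eucl D → Eucl D} (hv : ContDiffOn ℝ n v (closure Ω)) (hmn : m + 1 + 1 ≤ n) :
    ContDiffOn ℝ m (vecLapl Ω v) (closure Ω) := by
  have h2 : ContDiffOn ℝ 2 v (closure Ω) := by
    refine hv.of_le (le_trans ?_ hmn)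
    rw [add_assoc, one_add_one_eq_two]
    exact le_add_self
  refine ContDiffOn.congr (f := fun x => ∑ j, partialDeriv Ω j (partialDeriv Ω j v) x) ?_
    fun x hx => vecLapl_eq_sum_partialDeriv hu h2 hx
  exact ContDiffOn.sum fun j _ => contDiffOn_partialDeriv hu j
    (contDiffOn_partialDeriv hu j hv hmn) le_rfl

lemma div_grad (hu : UniqueDiffOn ℝ (closure Ω)) {φ : Eucl D → ℝ}
    (hφ : ContDiffOn ℝ 2 φ (closure Ω)) {x : Eucl D} (hx : x ∈ closure Ω) :
    div Ω (grad Ω φ) x = lapl Ω φ x := by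
  rw [div_eq_sum_pd hu (contDiffOn_grad hu hφ (by norm_num)) hx, lapl_eq_sum_pd hu hφ hx]
  simp_rw [grad_apply]

/-- The divergence commutes with the Laplacian. -/
lemma div_vecLapl (ho : IsOpen Ω) (hu : UniqueDiffOn ℝ (closure Ω)) {v : Eucl D → Eucl D}
    (hv : ContDiffOn ℝ 3 v (closure Ω)) {x : Eucl D} (hx : x ∈ Ω) :
    div Ω (vecLapl Ω v) x = ∑ j, pd Ω j (pd Ω j (div Ω v)) x := by
  have hc : ∀ i, ContDiffOn ℝ 3 (fun y => v y i) (closure Ω) := contDiffOn_coord hv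
  have hp : ∀ i j, ContDiffOn ℝ 2 (pd Ω j (fun y => v y i)) (closure Ω) := fun i j =>
    contDiffOn_pd hu j (hc i) (by norm_num)
  have hpp : ∀ i j k, ContDiffOn ℝ 1 (pd Ω k (pd Ω j (fun y => v y i))) (closure Ω) :=
    fun i j k => contDiffOn_pd hu k (hp i j) (by norm_num)
  have hsub : Ω ⊆ closure Ω := subset_closure
  have e1 : div Ω (vecLapl Ω v) x =
      ∑ i, ∑ j, pd Ω i (pd Ω j (pd Ω j (fun y => v y i))) x := by
    rw [div_eq_sum_pd hu (contDiffOn_vecLapl hu hv (by norm_num)) (hsub hx)]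
    refine Finset.sum_congr rfl fun i _ => ?_
    rw [← pd_sum hu i _ (fun j => hpp i j j) (hsub hx)]
    exact pd_congr ho i (fun y hy => vecLapl_apply hu (hv.of_le (by norm_num)) (hsub hy) i) hx
  have e2 : ∀ j, pd Ω j (pd Ω j (div Ω v)) x =
      ∑ i, pd Ω j (pd Ω j (pd Ω i (fun y => v y i))) x := by
    intro j
    rw [← pd_sum hu j _ (fun i => hpp i i j) (hsub hx)]
    refine pd_congr ho j (fun y hy => ?_) hx
    rw [← pd_sum hu j _ (fun i => (hp i i).of_le (by norm_num)) (hsub hy)]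
    exact pd_congr ho j (fun z hz => div_eq_sum_pd hu (hv.of_le (by norm_num)) (hsub hz)) hy
  simp_rw [e1, e2]
  rw [Finset.sum_comm]
  refine Finset.sum_congr rfl fun j _ => Finset.sum_congr rfl fun i _ => ?_
  rw [pd_comm ho i j (hp i j) hx]
  exact pd_congr ho j (fun y hy => pd_comm ho i j ((hc i).of_le (by norm_num)) hy) hx

lemma div_add (hu : UniqueDiffOn ℝ (closure Ω)) {v w : Eucl D → Eucl D}
    (hv : ContDiffOn ℝ 1 v (closure Ω)) (hw : ContDiffOn ℝ 1 w (closure Ω)) {x : Eucl D}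
    (hx : x ∈ closure Ω) : div Ω (fun y => v y + w y) x = div Ω v x + div Ω w x := by
  rw [div_eq_sum_pd (v := fun y => v y + w y) hu (hv.add hw) hx, div_eq_sum_pd hu hv hx,
    div_eq_sum_pd hu hw hx,
    ← Finset.sum_add_distrib]
  exact Finset.sum_congr rfl fun i _ =>
    pd_add hu i (contDiffOn_coord hv i) (contDiffOn_coord hw i) hx

lemma div_sub (hu : UniqueDiffOn ℝ (closure Ω)) {v w : Eucl D → Eucl D}
    (hv : ContDiffOn ℝ 1 v (closure Ω)) (hw : ContDiffOn ℝ 1 w (closure Ω)) {x : Eucl D}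
    (hx : x ∈ closure Ω) : div Ω (fun y => v y - w y) x = div Ω v x - div Ω w x := by
  rw [div_eq_sum_pd (v := fun y => v y - w y) hu (hv.sub hw) hx, div_eq_sum_pd hu hv hx,
    div_eq_sum_pd hu hw hx,
    ← Finset.sum_sub_distrib]
  exact Finset.sum_congr rfl fun i _ =>
    pd_sub hu i (contDiffOn_coord hv i) (contDiffOn_coord hw i) hx

/-- The product rule for a scalar field times a vector field. -/
lemma div_smul (hu : UniqueDiffOn ℝ (closure Ω)) {f : Eucl D → ℝ} {v : Eucl D → Eucl D}
    (hf : ContDiffOn ℝ 1 f (closure Ω)) (hv : ContDiffOn ℝ 1 v (closure Ω)) {x : Eucl D}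
    (hx : x ∈ closure Ω) :
    div Ω (fun y => f y • v y) x = f x * div Ω v x + inner ℝ (v x) (grad Ω f x) := by
  rw [div_eq_sum_pd (v := fun y => f y • v y) hu (hf.smul hv) hx, div_eq_sum_pd hu hv hx,
    Finset.mul_sum,
    EuclideanSpace.inner_eq_star_dotProduct, dotProduct, ← Finset.sum_add_distrib]
  refine Finset.sum_congr rfl fun i _ => ?_
  have := pd_mul hu i hf (contDiffOn_coord hv i) hx
  simp only [PiLp.smul_apply, smul_eq_mul, this, grad_apply, Pi.star_apply, star_trivial]
  ring

lemma div_const_smul (hu : UniqueDiffOn ℝ (closure Ω)) (c : ℝ) {v : Eucl D → Eucl D}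
    (hv : ContDiffOn ℝ 1 v (closure Ω)) {x : Eucl D} (hx : x ∈ closure Ω) :
    div Ω (fun y => c • v y) x = c * div Ω v x := by
  rw [div_eq_sum_pd (v := fun y => c • v y) hu (hv.const_smul c) hx, div_eq_sum_pd hu hv hx,
    Finset.mul_sum]
  exact Finset.sum_congr rfl fun i _ => pd_const_mul hu i c (contDiffOn_coord hv i) hx

lemma div_sum (hu : UniqueDiffOn ℝ (closure Ω)) {ι : Type*} (t : Finset ι)
    {v : ι → Eucl D → Eucl D} (hv : ∀ i, ContDiffOn ℝ 1 (v i) (closure Ω)) {x : Eucl D}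
    (hx : x ∈ closure Ω) : div Ω (fun y => ∑ i ∈ t, v i y) x = ∑ i ∈ t, div Ω (v i) x := by
  rw [div_eq_sum_pd hu (ContDiffOn.sum fun i _ => hv i) hx]
  simp_rw [fun i => div_eq_sum_pd hu (hv i) hx]
  rw [Finset.sum_comm]
  refine Finset.sum_congr rfl fun i _ => ?_
  rw [← pd_sum hu i _ (fun k => contDiffOn_coord (hv k) i) hx]
  simp [WithLp.ofLp_sum]

lemma div_congr (ho : IsOpen Ω) {v w : Eucl D → Eucl D} (h : EqOn v w Ω) :
    EqOn (div Ω v) (div Ω w) Ω := by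
  intro x hx
  have : v =ᶠ[𝓝 x] w := h.eventuallyEq_of_mem (ho.mem_nhds hx)
  simp only [div, partialDeriv, fderivWithin_of_mem_nhds (closure_mem_nhds_of_mem ho hx),
    this.fderiv_eq]

/-! ### Boundary charts -/

/-- `H` is a Lipschitz defining function of `Ω` in the open set `U`: `Ω` is the set `0 < H` there,
and `H` decreases at unit speed along the vertical unit vector `e`.  If `Ω` lies below the graph
of `h`, then `H y` is the signed vertical distance from `y` up to the graph. -/
structure IsBoundaryChart (Ω U : Set (Eucl D)) (e : Eucl D) (L : NNReal) (H : Eucl D → ℝ) :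
    Prop where
  norm_eq : ‖e‖ = 1
  isOpen : IsOpen U
  lipschitz : LipschitzWith L H
  vertical : ∀ y s, H (y + s • e) = H y - s
  mem_iff : ∀ y ∈ U, y ∈ Ω ↔ 0 < H y

lemma IsLipschitzDomain.exists_boundaryChart (hΩ : IsLipschitzDomain Ω) {x : Eucl D}
    (hx : x ∈ frontier Ω) : ∃ U e L H, x ∈ U ∧ IsBoundaryChart Ω U e L H := by
  obtain ⟨e, U, K, h, he, hU, hxU, hK, hmem⟩ := hΩ.lipschitz_boundary x hx
  have hee : inner ℝ e e = (1 : ℝ) := by rw [real_inner_self_eq_norm_sq, he]; norm_num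
  let ℓ : Eucl D →L[ℝ] ℝ := innerSL ℝ e
  let p : Eucl D →L[ℝ] Eucl D := ContinuousLinearMap.id ℝ _ - ℓ.smulRight e
  have hℓ : ∀ y, ℓ y = inner ℝ y e := fun y => by
    simp only [ℓ, innerSL_apply_apply]; exact real_inner_comm _ _
  have hp : ∀ y, p y = y - (inner ℝ y e : ℝ) • e := fun y => by
    simp [p, hℓ]
  refine ⟨U, e, K * ‖p‖₊ + ‖ℓ‖₊, fun y => h (p y) - ℓ y, hxU, he, hU,
    (hK.comp p.lipschitz).sub ℓ.lipschitz, fun y s => ?_, fun y hy => ?_⟩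
  · have : p (y + s • e) = p y := by
      simp only [hp, inner_add_left, inner_smul_left, hee]
      simp only [RCLike.conj_to_real, mul_one, add_smul]; abel
    rw [this, hℓ, hℓ, inner_add_left, inner_smul_left, hee]
    simp only [RCLike.conj_to_real, mul_one]; ring
  · rw [hmem y hy, hp, hℓ, sub_pos]

lemma IsBoundaryChart.eq_zero {U : Set (Eucl D)} {e : Eucl D} {L : NNReal} {H : Eucl D → ℝ}
    (hc : IsBoundaryChart Ω U e L H) (ho : IsOpen Ω) {x : Eucl D} (hx : x ∈ frontier Ω)
    (hxU : x ∈ U) : H x = 0 := by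
  refine le_antisymm ?_ ?_
  · by_contra! h
    exact (ho.frontier_eq ▸ hx).2 ((hc.mem_iff x hxU).2 h)
  · by_contra! h
    have h1 : ∀ᶠ y in 𝓝 x, H y < 0 := hc.lipschitz.continuous.continuousAt.eventually_lt_const h
    have h2 : ∃ᶠ y in 𝓝 x, y ∈ Ω := mem_closure_iff_frequently.1 hx.1
    obtain ⟨y, hy, hy1, hyU⟩ := (h2.and_eventually (h1.and (hc.isOpen.mem_nhds hxU))).exists
    exact absurd ((hc.mem_iff y hyU).1 hy) (not_lt.2 hy1.le)

/-- The zero set of a defining function consists of boundary points. -/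
lemma IsBoundaryChart.mem_frontier {U : Set (Eucl D)} {e : Eucl D} {L : NNReal}
    {H : Eucl D → ℝ} (hc : IsBoundaryChart Ω U e L H) (ho : IsOpen Ω) {x : Eucl D}
    (hxU : x ∈ U) (hx : H x = 0) : x ∈ frontier Ω := by
  rw [ho.frontier_eq]
  refine ⟨?_, fun h => absurd ((hc.mem_iff x hxU).1 h) (by simp [hx])⟩
  have ht : Tendsto (fun s : ℝ => x + s • e) (𝓝[<] 0) (𝓝 x) := by
    have : Continuous fun s : ℝ => x + s • e := by fun_prop
    simpa using (this.tendsto 0).mono_left nhdsWithin_le_nhds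
  refine mem_closure_of_tendsto ht ?_
  filter_upwards [self_mem_nhdsWithin, ht (hc.isOpen.mem_nhds hxU)] with s hs hsU
  rw [hc.mem_iff _ hsU, hc.vertical, hx]
  simpa using hs

/-- A boundary point has an open cone of directions into `Ω`, so derivatives within `closure Ω`
are unique. -/
lemma IsLipschitzDomain.uniqueDiffOn (hΩ : IsLipschitzDomain Ω) :
    UniqueDiffOn ℝ (closure Ω) := by
  intro x hx
  by_cases hxΩ : x ∈ Ω
  · exact uniqueDiffWithinAt_of_mem_nhds (closure_mem_nhds_of_mem hΩ.isOpen hxΩ)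
  have hxf : x ∈ frontier Ω := by rw [hΩ.isOpen.frontier_eq]; exact ⟨hx, hxΩ⟩
  obtain ⟨U, e, L, H, hxU, hc⟩ := hΩ.exists_boundaryChart hxf
  have hx0 := hc.eq_zero hΩ.isOpen hxf hxU
  have hee : inner ℝ e e = (1 : ℝ) := by rw [real_inner_self_eq_norm_sq, hc.norm_eq]; norm_num
  let ℓ : Eucl D →L[ℝ] ℝ := innerSL ℝ e
  have hℓe : ℓ e = 1 := by simpa [ℓ] using hee
  let p : Eucl D →L[ℝ] Eucl D := ContinuousLinearMap.id ℝ _ - ℓ.smulRight e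
  have hpe : p e = 0 := by simp [p, hℓe]
  -- The cone below `x` that is steeper than the Lipschitz constant of `H`.
  let C : Set (Eucl D) := {y | L * ‖p (y - x)‖ + ℓ (y - x) < 0}
  have hCo : IsOpen C := by
    refine isOpen_lt ?_ continuous_const
    fun_prop
  have hmem : ∀ t : ℝ, 0 < t → x - t • e ∈ C := by
    intro t ht
    simp [C, hpe, hℓe, ht]
  have hCc : Convex ℝ C := by
    intro y hy z hz a b ha hb hab
    have e1 : a • y + b • z - x = a • (y - x) + b • (z - x) := by
      rw [smul_sub, smul_sub]
      nth_rewrite 1 [← one_smul ℝ x]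
      rw [← hab, add_smul]; abel
    simp only [C, mem_ofPred_eq] at hy hz ⊢
    rw [e1, map_add, map_add, map_smul, map_smul, map_smul, map_smul]
    have h1 : ‖a • p (y - x) + b • p (z - x)‖ ≤ a * ‖p (y - x)‖ + b * ‖p (z - x)‖ := by
      refine (norm_add_le _ _).trans_eq ?_
      rw [norm_smul, norm_smul, Real.norm_of_nonneg ha, Real.norm_of_nonneg hb]
    have h2 := mul_le_mul_of_nonneg_left h1 L.coe_nonneg
    simp only [smul_eq_mul]
    have h3 : a * (L * ‖p (y - x)‖ + ℓ (y - x)) + b * (L * ‖p (z - x)‖ + ℓ (z - x)) < 0 := by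
      rcases ha.eq_or_lt with rfl | ha'
      · have : b = 1 := by linarith
        subst this; linarith
      · have := mul_neg_of_pos_of_neg ha' hy
        have := mul_nonpos_of_nonneg_of_nonpos hb hz.le
        linarith
    linarith
  have hxC : x ∈ closure C := by
    have ht : Tendsto (fun s : ℝ => x - s • e) (𝓝[>] 0) (𝓝 x) := by
      have : Continuous fun s : ℝ => x - s • e := by fun_prop
      simpa using (this.tendsto 0).mono_left nhdsWithin_le_nhds
    exact mem_closure_of_tendsto ht (by
      filter_upwards [self_mem_nhdsWithin] with s hs using hmem s hs)
  have hsub : C ∩ U ⊆ Ω := by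
    rintro y ⟨hy, hyU⟩
    rw [hc.mem_iff y hyU]
    have hsplit : x + p (y - x) + ℓ (y - x) • e = y := by
      simp only [p, _root_.sub_apply, ContinuousLinearMap.id_apply,
        ContinuousLinearMap.smulRight_apply]
      abel
    have h1 : H y = H (x + p (y - x)) - ℓ (y - x) := by
      rw [← hc.vertical, hsplit]
    have h2 := hc.lipschitz.dist_le_mul (x + p (y - x)) x
    rw [Real.dist_eq, hx0, dist_eq_norm, add_sub_cancel_left] at h2
    have h3 := (abs_le.1 h2).1
    simp only [C, mem_ofPred_eq] at hy
    linarith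
  have h1 : UniqueDiffWithinAt ℝ C x :=
    uniqueDiffWithinAt_convex hCc
      ⟨x - (1 : ℝ) • e, by rw [hCo.interior_eq]; exact hmem 1 one_pos⟩ hxC
  exact (h1.inter (hc.isOpen.mem_nhds hxU)).mono (hsub.trans subset_closure)

/-- Where a defining function is differentiable, its normalized gradient is the inner normal. -/
lemma IsBoundaryChart.isOutwardNormal {U : Set (Eucl D)} {e : Eucl D} {L : NNReal}
    {H : Eucl D → ℝ} (hc : IsBoundaryChart Ω U e L H) (ho : IsOpen Ω) {x : Eucl D}
    (hxU : x ∈ U) (hx : H x = 0) {g : Eucl D} (hg : HasGradientAt H g x) (hg0 : g ≠ 0) :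
    IsOutwardNormal Ω x (-(‖g‖⁻¹ • g)) := by
  have hgn : 0 < ‖g‖ := norm_pos_iff.2 hg0
  refine ⟨hc.mem_frontier ho hxU hx, ?_, fun ε hε => ?_⟩
  · rw [norm_neg, norm_smul, norm_inv, norm_norm, inv_mul_cancel₀ hgn.ne']
  have hlo := (hasGradientAt_iff_isLittleO.1 hg).def (c := ε / 2 * ‖g‖) (by positivity)
  filter_upwards [hlo, hc.isOpen.mem_nhds hxU] with y hy hyU
  rw [hx, sub_zero, Real.norm_eq_abs] at hy
  have hin : inner ℝ (y - x) (-(‖g‖⁻¹ • g)) = -(‖g‖⁻¹ * inner ℝ g (y - x)) := by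
    rw [inner_neg_right, inner_smul_right, real_inner_comm]
  obtain ⟨hy1, hy2⟩ := abs_le.1 hy
  have hiv : ‖g‖ * (‖g‖⁻¹ * inner ℝ g (y - x)) = inner ℝ g (y - x) :=
    mul_inv_cancel_left₀ hgn.ne' _
  have hnn : 0 ≤ ε * ‖g‖ * ‖y - x‖ := by positivity
  rw [hin, hc.mem_iff y hyU]
  constructor
  · intro h
    have := mul_lt_mul_of_pos_left (neg_lt_neg h) hgn
    rw [neg_neg, neg_neg, hiv] at this
    linarith
  · intro h
    have := mul_lt_mul_of_pos_left h hgn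
    rw [mul_neg, hiv] at this
    intro h'
    linarith

/-! ### Integration by parts against Lipschitz functions -/

lemma lipschitzWith_smoothTransition : ∃ C, LipschitzWith C Real.smoothTransition := by
  have hd : Differentiable ℝ Real.smoothTransition :=
    (Real.smoothTransition.contDiff (n := 1)).differentiable one_ne_zero
  have hcont : Continuous (deriv Real.smoothTransition) :=
    (Real.smoothTransition.contDiff (n := 1)).continuous_deriv le_rfl
  have hsupp : HasCompactSupport (deriv Real.smoothTransition) := by
    refine HasCompactSupport.intro (isCompact_Icc (a := (0 : ℝ)) (b := 1)) fun s hs => ?_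
    rw [mem_Icc, not_and_or, not_le, not_le] at hs
    rcases hs with hs | hs
    · have : Real.smoothTransition =ᶠ[𝓝 s] fun _ => 0 := by
        filter_upwards [Iio_mem_nhds hs] with t ht
          using Real.smoothTransition.zero_of_nonpos (le_of_lt ht)
      simp [this.deriv_eq]
    · have : Real.smoothTransition =ᶠ[𝓝 s] fun _ => 1 := by
        filter_upwards [Ioi_mem_nhds hs] with t ht
          using Real.smoothTransition.one_of_one_le (le_of_lt ht)
      simp [this.deriv_eq]
  obtain ⟨C, hC⟩ := hsupp.exists_bound_of_continuous hcont
  exact ⟨C.toNNReal, lipschitzWith_of_nnnorm_deriv_le hd fun s => by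
    rw [← NNReal.coe_le_coe, coe_nnnorm]; exact (hC s).trans (Real.le_coe_toNNReal C)⟩

lemma clm_apply_eq_sum (A : Eucl D →L[ℝ] ℝ) (v : Eucl D) :
    A v = ∑ i, A (EuclideanSpace.single i 1) * v i := by
  conv_lhs => rw [← (EuclideanSpace.basisFun (Fin D) ℝ).sum_repr v]
  simp [map_sum, mul_comm]

/-- Integration by parts of a Lipschitz function against a compactly supported `C^1` field. -/
lemma integral_fderiv_apply_of_lipschitz {ψ : Eucl D → ℝ} {C : NNReal} (hψ : LipschitzWith C ψ)
    {G : Eucl D → Eucl D} (hG : ContDiff ℝ 1 G) (hGc : HasCompactSupport G) :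
    Integrable (fun y => fderiv ℝ ψ y (G y)) ∧
    ∫ y, fderiv ℝ ψ y (G y) =
      -∫ y, ψ y * ∑ i, fderiv ℝ (fun z => G z i) y (EuclideanSpace.single i 1) := by
  have hGi : ∀ i, ContDiff ℝ 1 (fun z => G z i) := fun i => contDiff_euclidean.1 hG i
  have hGic : ∀ i, HasCompactSupport (fun z => G z i) := fun i =>
    hGc.comp_left (g := fun v : Eucl D => v i) rfl
  have hae : (fun y => fderiv ℝ ψ y (G y)) =ᵐ[volume]
      fun y => ∑ i, lineDeriv ℝ ψ y (EuclideanSpace.single i 1) * G y i := by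
    filter_upwards [hψ.ae_differentiableAt] with y hy
    rw [clm_apply_eq_sum]
    exact Finset.sum_congr rfl fun i _ => by rw [hy.lineDeriv_eq_fderiv]
  have hint : ∀ i : Fin D, Integrable
      (fun y => lineDeriv ℝ ψ y (EuclideanSpace.single i 1) * G y i) := fun i =>
    ((hGi i).continuous.integrable_of_hasCompactSupport (hGic i)).bdd_mul
      (c := C * ‖EuclideanSpace.single i (1 : ℝ)‖)
      (aestronglyMeasurable_lineDeriv hψ.continuous _)
      (.of_forall fun y => norm_lineDeriv_le_of_lipschitz ℝ hψ)
  have hint2 : ∀ i : Fin D, Integrable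
      (fun y => ψ y * fderiv ℝ (fun z => G z i) y (EuclideanSpace.single i 1)) := fun i => by
    refine Continuous.integrable_of_hasCompactSupport (hψ.continuous.mul
      (((hGi i).continuous_fderiv one_ne_zero).clm_apply continuous_const)) ?_
    exact (((hGic i).fderiv ℝ).comp_left (g := fun A : Eucl D →L[ℝ] ℝ =>
      A (EuclideanSpace.single i 1)) rfl).mul_left
  refine ⟨(integrable_finsetSum _ fun i _ => hint i).congr hae.symm, ?_⟩
  rw [integral_congr_ae hae, integral_finsetSum _ fun i _ => hint i, ← integral_neg]
  simp_rw [Finset.mul_sum, ← Finset.sum_neg_distrib]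
  rw [integral_finsetSum (f := fun i y => -(ψ y * fderiv ℝ (fun z => G z i) y
    (EuclideanSpace.single i 1))) _ fun i _ => (hint2 i).neg]
  refine Finset.sum_congr rfl fun i _ => ?_
  obtain ⟨C', hC'⟩ := (hGi i).lipschitzWith_of_hasCompactSupport (hGic i) one_ne_zero
  rw [hψ.integral_lineDeriv_mul_eq hC' (hGic i)]
  refine integral_congr_ae (.of_forall fun y => ?_)
  have hd : DifferentiableAt ℝ (fun z => G z i) y := (hGi i).differentiable one_ne_zero y
  simp only [hd.lineDeriv_eq_fderiv, map_neg]
  ring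

/-! ### The divergence theorem for fields without normal component -/

lemma exists_contDiff_eq_one_nhds {K : Set (Eucl D)} (hK : IsCompact K) (ho : IsOpen Ω)
    (h : K ⊆ Ω) : ∃ θ : Eucl D → ℝ, ContDiff ℝ 1 θ ∧ (∀ x ∈ K, ∀ᶠ y in 𝓝 x, θ y = 1) ∧
      HasCompactSupport θ ∧ tsupport θ ⊆ Ω ∧ ∀ x, θ x ∈ Icc 0 1 := by
  obtain ⟨K', hK', h1, h2⟩ := exists_compact_between hK ho h
  obtain ⟨f, hf1, hf0, hf⟩ := exists_contMDiffMap_one_nhds_of_subset_interior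
    (n := 1) (modelWithCornersSelf ℝ (Eucl D)) hK.isClosed h1
  have hs : tsupport f ⊆ K' := closure_minimal (fun x hx => by
    by_contra hx'; exact hx (hf0 x hx')) hK'.isClosed
  exact ⟨f, f.contMDiff.contDiff, fun x hx => eventually_nhdsSet_iff_forall.1 hf1 x hx,
    hK'.of_isClosed_subset (isClosed_tsupport _) hs, hs.trans h2, hf⟩

lemma contDiff_smul_of_tsupport_subset (ho : IsOpen Ω) {f : Eucl D → ℝ} {F : Eucl D → Eucl D}
    (hf : ContDiff ℝ 1 f) (hs : tsupport f ⊆ Ω) (hF : ContDiffOn ℝ 1 F (closure Ω)) :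
    ContDiff ℝ 1 (fun y => f y • F y) := by
  refine contDiff_iff_contDiffAt.2 fun y => ?_
  by_cases hy : y ∈ tsupport f
  · exact hf.contDiffAt.smul (hF.contDiffAt (closure_mem_nhds_of_mem ho (hs hy)))
  · have h0 : (fun y => f y • F y) =ᶠ[𝓝 y] fun _ => 0 := by
      filter_upwards [notMem_tsupport_iff_eventuallyEq.1 hy] with z hz
      simp [hz]
    exact contDiffAt_const.congr_of_eventuallyEq h0

lemma integrableOn_of_continuousOn_closure (hb : Bornology.IsBounded Ω) {f : Eucl D → ℝ}
    (hf : ContinuousOn f (closure Ω)) : IntegrableOn f Ω :=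
  (hf.integrableOn_compact hb.isCompact_closure).mono_set subset_closure

lemma div_eq_of_eventuallyEq (ho : IsOpen Ω) {v G : Eucl D → Eucl D} (hG : ContDiff ℝ 1 G)
    {x : Eucl D} (hx : x ∈ Ω) (h : G =ᶠ[𝓝 x] v) :
    ∑ i, fderiv ℝ (fun z => G z i) x (EuclideanSpace.single i 1) = div Ω v x := by
  have hv : div Ω v x = ∑ i, fderiv ℝ v x (EuclideanSpace.single i 1) i := by
    simp only [div, partialDeriv, fderivWithin_of_mem_nhds (closure_mem_nhds_of_mem ho hx)]
  rw [hv, ← h.fderiv_eq]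
  refine Finset.sum_congr rfl fun i _ => ?_
  have h1 := (EuclideanSpace.proj i : Eucl D →L[ℝ] ℝ).hasFDerivAt.comp x
    (hG.differentiable one_ne_zero x).hasFDerivAt
  have h2 : (EuclideanSpace.proj i : Eucl D →L[ℝ] ℝ) ∘ G = fun z => G z i := rfl
  rw [← h2, h1.fderiv]
  rfl

/-- A field supported near a point of `Ω` has a divergence of mean zero. -/
lemma integral_div_bump_interior (ho : IsOpen Ω) {f : Eucl D → ℝ} {F : Eucl D → Eucl D}
    (hf : ContDiff ℝ 1 f) (hc : HasCompactSupport f) (hs : tsupport f ⊆ Ω)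
    (hF : ContDiffOn ℝ 1 F (closure Ω)) :
    ∫ x in Ω, div Ω (fun y => f y • F y) x = 0 := by
  have hG := contDiff_smul_of_tsupport_subset ho hf hs hF
  have h := (integral_fderiv_apply_of_lipschitz (LipschitzWith.const (1 : ℝ)) hG
    (hc.smul_right (f' := F))).2
  simp only [fderiv_fun_const, Pi.zero_apply, _root_.zero_apply, integral_zero,
    one_mul] at h
  rw [← integral_indicator ho.measurableSet, ← neg_eq_zero, h]
  congr 1
  refine integral_congr_ae (.of_forall fun y => ?_)
  by_cases hy : y ∈ Ω
  · simp only [indicator_of_mem hy]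
    exact (div_eq_of_eventuallyEq ho hG hy .rfl).symm
  · have h0 : (fun z => f z • F z) =ᶠ[𝓝 y] 0 := by
      have := notMem_tsupport_iff_eventuallyEq.1 (fun h => hy (hs h))
      filter_upwards [this] with z hz
      simp [hz]
    simp only [indicator_of_notMem hy]
    refine (Finset.sum_eq_zero fun i _ => ?_).symm
    have : (fun z => (f z • F z) i) =ᶠ[𝓝 y] fun _ => 0 := by
      filter_upwards [h0] with z hz
      simp only [hz]; rfl
    rw [this.fderiv_eq]; simp

/-- The cutoff `ψ_ε = η(H/ε - 1)` with a smooth step `η`: it vanishes where `H ≤ ε` and equals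
`1` where `2ε ≤ H`. -/
def cutoff (H : Eucl D → ℝ) (ε : ℝ) (y : Eucl D) : ℝ := Real.smoothTransition (H y / ε - 1)

/-- The factor `ε⁻¹ η'(H/ε - 1)` in the gradient of `cutoff H ε`; it is concentrated on the layer
`ε ≤ H ≤ 2ε` along the boundary. -/
def cutoffDeriv (H : Eucl D → ℝ) (ε : ℝ) (y : Eucl D) : ℝ :=
  ε⁻¹ * deriv Real.smoothTransition (H y / ε - 1)

lemma lipschitzWith_cutoff {H : Eucl D → ℝ} {L : NNReal} (hH : LipschitzWith L H) (ε : ℝ) :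
    ∃ C, LipschitzWith C (cutoff H ε) := by
  obtain ⟨C, hC⟩ := lipschitzWith_smoothTransition
  have h1 : LipschitzWith (‖ε⁻¹‖₊) (fun t : ℝ => t / ε - 1) := by
    refine LipschitzWith.of_dist_le_mul fun a b => ?_
    rw [Real.dist_eq, Real.dist_eq, coe_nnnorm, Real.norm_eq_abs, ← abs_mul]
    refine le_of_eq (congrArg _ ?_)
    ring
  exact ⟨_, hC.comp (h1.comp hH)⟩

lemma cutoffDeriv_nonneg (H : Eucl D → ℝ) {ε : ℝ} (hε : 0 < ε) (y : Eucl D) :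
    0 ≤ cutoffDeriv H ε y :=
  mul_nonneg (inv_nonneg.2 hε.le) (Real.smoothTransition.monotone.deriv_nonneg)

lemma cutoff_mem_Icc (H : Eucl D → ℝ) (ε : ℝ) (y : Eucl D) : cutoff H ε y ∈ Icc (0 : ℝ) 1 :=
  ⟨Real.smoothTransition.nonneg _, Real.smoothTransition.le_one _⟩

lemma cutoffDeriv_eq_zero {H : Eucl D → ℝ} {ε : ℝ} (hε : 0 < ε) {y : Eucl D}
    (hy : H y < ε ∨ 2 * ε < H y) : cutoffDeriv H ε y = 0 := by
  rw [cutoffDeriv]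
  refine mul_eq_zero_of_right _ ?_
  rcases hy with hy | hy
  · have hy' : H y / ε - 1 < 0 := by rw [sub_neg, div_lt_one hε]; exact hy
    have : Real.smoothTransition =ᶠ[𝓝 (H y / ε - 1)] fun _ => 0 := by
      filter_upwards [Iio_mem_nhds hy'] with t ht
        using Real.smoothTransition.zero_of_nonpos (le_of_lt ht)
    simp [this.deriv_eq]
  · have hy' : 1 < H y / ε - 1 := by rw [lt_sub_iff_add_lt, lt_div_iff₀ hε]; linarith
    have : Real.smoothTransition =ᶠ[𝓝 (H y / ε - 1)] fun _ => 1 := by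
      filter_upwards [Ioi_mem_nhds hy'] with t ht
        using Real.smoothTransition.one_of_one_le (le_of_lt ht)
    simp [this.deriv_eq]

lemma fderiv_cutoff {H : Eucl D → ℝ} {ε : ℝ} {y : Eucl D} (hd : DifferentiableAt ℝ H y)
    (v : Eucl D) : fderiv ℝ (cutoff H ε) y v = cutoffDeriv H ε y * fderiv ℝ H y v := by
  have hη : HasDerivAt Real.smoothTransition (deriv Real.smoothTransition (H y / ε - 1))
      (H y / ε - 1) :=
    ((Real.smoothTransition.contDiff (n := 1)).differentiable one_ne_zero _).hasDerivAt
  have h1 : HasFDerivAt (fun z => H z / ε - 1) (ε⁻¹ • fderiv ℝ H y) y := by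
    simp_rw [div_eq_inv_mul]
    exact (hd.hasFDerivAt.const_mul ε⁻¹).sub_const 1
  have h2 : fderiv ℝ (cutoff H ε) y = _ := (hη.comp_hasFDerivAt y h1).fderiv
  rw [h2, cutoffDeriv]
  simp only [_root_.smul_apply, smul_eq_mul]
  ring

namespace IsBoundaryChart

variable {U : Set (Eucl D)} {e : Eucl D} {L : NNReal} {H : Eucl D → ℝ}

lemma fderiv_vertical (hc : IsBoundaryChart Ω U e L H) {y : Eucl D}
    (hd : DifferentiableAt ℝ H y) : fderiv ℝ H y e = -1 := by
  have h1 : HasDerivAt (fun s : ℝ => H (y + s • e)) (fderiv ℝ H y e) 0 := by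
    exact hd.hasFDerivAt.hasLineDerivAt e
  have h2 : HasDerivAt (fun s : ℝ => H (y + s • e)) (-1) 0 := by
    simp_rw [hc.vertical]
    simpa using (hasDerivAt_id (0 : ℝ)).const_sub (H y)
  exact h1.unique h2

/-- The gradient of a defining function is constant along vertical lines; so, by the boundary
condition, it annihilates the value of `F` at the boundary point above `y`. -/
lemma fderiv_apply_eq_zero (hc : IsBoundaryChart Ω U e L H) (ho : IsOpen Ω)
    {F : Eucl D → Eucl D} (hn : NoPenetration Ω F) {y : Eucl D} (hd : DifferentiableAt ℝ H y)
    (hyU : y + H y • e ∈ U) : fderiv ℝ H y (F (y + H y • e)) = 0 := by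
  set z := y + H y • e with hz
  have hHz : H z = 0 := by rw [hz, hc.vertical, sub_self]
  have hshift : ∀ w, H w = H (w + -(H y • e)) - H y := fun w => by
    rw [← hc.vertical]; simp
  have hy : z + -(H y • e) = y := by simp [hz]
  have hdz : HasFDerivAt H (fderiv ℝ H y) z := by
    have h1 : HasFDerivAt H (fderiv ℝ H y) (z + -(H y • e)) := by rw [hy]; exact hd.hasFDerivAt
    have h2 := ((hasFDerivAt_comp_add_right _).2 h1).sub_const (H y)
    exact h2.congr_of_eventuallyEq (.of_forall hshift)
  set g := (InnerProductSpace.toDual ℝ (Eucl D)).symm (fderiv ℝ H y) with hg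
  have hgA : ∀ v, inner ℝ g v = fderiv ℝ H y v := fun v => by
    rw [hg, InnerProductSpace.toDual_symm_apply]
  have hgrad : HasGradientAt H g z := by
    rw [hasGradientAt_iff_hasFDerivAt, hg, LinearIsometryEquiv.apply_symm_apply]
    exact hdz
  have hg0 : g ≠ 0 := by
    intro h0
    have := hgA e
    rw [h0, inner_zero_left, hc.fderiv_vertical hd] at this
    norm_num at this
  have := hn z _ (hc.isOutwardNormal ho hyU hHz hgrad hg0)
  rw [inner_neg_left, inner_smul_left, neg_eq_zero] at this
  rcases mul_eq_zero.1 this with h | h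
  · exact absurd h (by simpa using hg0)
  · rw [← hgA, h]

/-- The boundary layers have uniformly bounded weight: `∫ f ε⁻¹ η'(H/ε - 1)` is the integral of
`ψ_ε ∂_e f`. -/
lemma integral_mul_cutoffDeriv_le (hc : IsBoundaryChart Ω U e L H) {f : Eucl D → ℝ}
    (hf : ContDiff ℝ 1 f) (hfc : HasCompactSupport f) (ε : ℝ) :
    Integrable (fun y => f y * cutoffDeriv H ε y) ∧
    ∫ y, f y * cutoffDeriv H ε y ≤ ∫ y, |∑ i, fderiv ℝ (fun z => f z * e i) y
      (EuclideanSpace.single i 1)| := by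
  obtain ⟨C, hC⟩ := lipschitzWith_cutoff hc.lipschitz ε
  have hG : ContDiff ℝ 1 (fun y => f y • e) := hf.smul contDiff_const
  obtain ⟨h1, h2⟩ := integral_fderiv_apply_of_lipschitz hC hG (hfc.smul_right (f' := fun _ => e))
  have hae : (fun y => fderiv ℝ (cutoff H ε) y (f y • e)) =ᵐ[volume]
      fun y => -(f y * cutoffDeriv H ε y) := by
    filter_upwards [hc.lipschitz.ae_differentiableAt] with y hy
    rw [map_smul, fderiv_cutoff hy, hc.fderiv_vertical hy, smul_eq_mul]
    ring
  have hint : Integrable (fun y => f y * cutoffDeriv H ε y) := by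
    simpa using (h1.congr hae).neg
  refine ⟨hint, ?_⟩
  rw [integral_congr_ae hae, integral_neg, neg_inj] at h2
  rw [h2]
  have hGi : ∀ i, ContDiff ℝ 1 (fun z => f z * e i) := fun i => hf.mul contDiff_const
  have hcont : Continuous fun y => ∑ i, fderiv ℝ (fun z => f z * e i) y
      (EuclideanSpace.single i 1) :=
    continuous_finsetSum _ fun i _ =>
      ((hGi i).continuous_fderiv one_ne_zero).clm_apply continuous_const
  have hsupp : HasCompactSupport fun y => ∑ i, fderiv ℝ (fun z => f z * e i) y
      (EuclideanSpace.single i 1) := by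
    refine HasCompactSupport.intro hfc fun y hy => Finset.sum_eq_zero fun i _ => ?_
    have h0 : (fun z => f z * e i) =ᶠ[𝓝 y] fun _ => 0 := by
      filter_upwards [notMem_tsupport_iff_eventuallyEq.1 hy] with z hz
      simp [hz]
    rw [h0.fderiv_eq]; simp
  have hi : Integrable fun y => |∑ i, fderiv ℝ (fun z => f z * e i) y
      (EuclideanSpace.single i 1)| :=
    hcont.abs.integrable_of_hasCompactSupport (hsupp.comp_left (g := fun t : ℝ => |t|) abs_zero)
  refine (Real.le_norm_self _).trans (norm_integral_le_of_norm_le hi (.of_forall fun y => ?_))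
  obtain ⟨h3, h4⟩ := cutoff_mem_Icc H ε y
  rw [norm_mul, Real.norm_of_nonneg h3, Real.norm_eq_abs]
  exact mul_le_of_le_one_left (abs_nonneg _) h4

/-- Integration by parts against the cutoff: only the component of `F` along `∇H` in the layer
`ε ≤ H ≤ 2ε` contributes. -/
lemma abs_integral_cutoff_mul_div_le (hc : IsBoundaryChart Ω U e L H) (ho : IsOpen Ω)
    {f : Eucl D → ℝ} {F : Eucl D → Eucl D} (hf : ContDiff ℝ 1 f) (hf0 : ∀ y, 0 ≤ f y)
    (hfc : HasCompactSupport f) (hfU : tsupport f ⊆ U) (hF : ContDiffOn ℝ 1 F (closure Ω))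
    {ε : ℝ} (hε : 0 < ε) {M : ℝ}
    (hM : ∀ y ∈ tsupport f, DifferentiableAt ℝ H y → ε ≤ H y → H y ≤ 2 * ε →
      |fderiv ℝ H y (F y)| ≤ M) :
    |∫ y in Ω, cutoff H ε y * div Ω (fun z => f z • F z) y| ≤
      M * ∫ y, f y * cutoffDeriv H ε y := by
  have hK : IsCompact (tsupport f ∩ {y | ε ≤ H y}) :=
    IsCompact.inter_right hfc (isClosed_le continuous_const hc.lipschitz.continuous)
  have hKΩ : tsupport f ∩ {y | ε ≤ H y} ⊆ Ω := fun y hy =>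
    (hc.mem_iff y (hfU hy.1)).2 (hε.trans_le hy.2)
  -- The localizer `θ` makes the field smooth on the whole space without changing it on the
  -- support of the cutoff.
  obtain ⟨θ, hθ, hθ1, hθc, hθΩ, hθI⟩ := exists_contDiff_eq_one_nhds hK ho hKΩ
  have htf : ContDiff ℝ 1 fun y => θ y * f y := hθ.mul hf
  have hts : tsupport (fun y => θ y * f y) ⊆ Ω :=
    (closure_mono (Function.support_mul_subset_left θ f)).trans hθΩ
  have hG := contDiff_smul_of_tsupport_subset ho htf hts hF
  obtain ⟨C, hC⟩ := lipschitzWith_cutoff hc.lipschitz ε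
  obtain ⟨h1, h2⟩ := integral_fderiv_apply_of_lipschitz hC hG
    ((hθc.mul_right (f' := f)).smul_right (f' := F))
  have hswap : ∫ y in Ω, cutoff H ε y * div Ω (fun z => f z • F z) y =
      ∫ y, cutoff H ε y * ∑ i, fderiv ℝ (fun z => ((θ z * f z) • F z) i) y
        (EuclideanSpace.single i 1) := by
    rw [← integral_indicator ho.measurableSet]
    refine integral_congr_ae (.of_forall fun y => ?_)
    by_cases hy : y ∈ Ω
    · simp only [indicator_of_mem hy]
      by_cases hcut : cutoff H ε y = 0
      · simp [hcut]
      have hHy : ε ≤ H y := by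
        by_contra! h
        refine hcut (Real.smoothTransition.zero_of_nonpos ?_)
        rw [sub_nonpos, div_le_one hε]
        exact h.le
      congr 1
      refine (div_eq_of_eventuallyEq ho hG hy ?_).symm
      by_cases hyf : y ∈ tsupport f
      · filter_upwards [hθ1 y ⟨hyf, hHy⟩] with z hz
        simp [hz]
      · filter_upwards [notMem_tsupport_iff_eventuallyEq.1 hyf] with z hz
        simp [hz]
    · simp only [indicator_of_notMem hy]
      refine (mul_eq_zero_of_right _ (Finset.sum_eq_zero fun i _ => ?_)).symm
      have h0 : (fun z => ((θ z * f z) • F z) i) =ᶠ[𝓝 y] fun _ => 0 := by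
        filter_upwards [notMem_tsupport_iff_eventuallyEq.1 fun h => hy (hts h)] with z hz
        simp only [Pi.zero_apply] at hz
        simp [hz]
      rw [h0.fderiv_eq]; simp
  have hint := (hc.integral_mul_cutoffDeriv_le hf hfc ε).1
  rw [hswap, ← abs_neg, ← h2, ← integral_const_mul, ← Real.norm_eq_abs]
  refine norm_integral_le_of_norm_le (hint.const_mul M) ?_
  filter_upwards [hc.lipschitz.ae_differentiableAt] with y hd
  have hw : 0 ≤ f y * cutoffDeriv H ε y := mul_nonneg (hf0 y) (cutoffDeriv_nonneg H hε y)
  rw [map_smul, fderiv_cutoff hd, smul_eq_mul, Real.norm_eq_abs,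
    show θ y * f y * (cutoffDeriv H ε y * fderiv ℝ H y (F y)) =
      θ y * ((f y * cutoffDeriv H ε y) * fderiv ℝ H y (F y)) by ring,
    abs_mul, abs_of_nonneg (hθI y).1, abs_mul, abs_of_nonneg hw]
  refine (mul_le_of_le_one_left (by positivity) (hθI y).2).trans ?_
  by_cases hw0 : f y * cutoffDeriv H ε y = 0
  · simp [hw0]
  rw [mul_comm]
  refine mul_le_mul_of_nonneg_right (hM y ?_ hd ?_ ?_) hw
  · exact subset_tsupport f (left_ne_zero_of_mul hw0)
  · by_contra! h
    exact right_ne_zero_of_mul hw0 (cutoffDeriv_eq_zero hε (.inl h))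
  · by_contra! h
    exact right_ne_zero_of_mul hw0 (cutoffDeriv_eq_zero hε (.inr h))

lemma tendsto_integral_cutoff_mul (hc : IsBoundaryChart Ω U e L H) (ho : IsOpen Ω)
    {g : Eucl D → ℝ} (hg : IntegrableOn g Ω) (hgU : ∀ y ∈ Ω, y ∉ U → g y = 0) :
    Tendsto (fun ε => ∫ y in Ω, cutoff H ε y * g y) (𝓝[>] 0) (𝓝 (∫ y in Ω, g y)) := by
  refine tendsto_integral_filter_of_dominated_convergence (fun y => ‖g y‖) ?_ ?_ hg.norm ?_
  · refine .of_forall fun ε => AEStronglyMeasurable.mul ?_ hg.aestronglyMeasurable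
    obtain ⟨C, hC⟩ := lipschitzWith_cutoff hc.lipschitz ε
    exact hC.continuous.aestronglyMeasurable
  · refine .of_forall fun ε => .of_forall fun y => ?_
    obtain ⟨h3, h4⟩ := cutoff_mem_Icc H ε y
    rw [norm_mul, Real.norm_of_nonneg h3]
    exact mul_le_of_le_one_left (norm_nonneg _) h4
  · refine (ae_restrict_iff' ho.measurableSet).2 (.of_forall fun y hy => ?_)
    by_cases hyU : y ∈ U
    · have hH : 0 < H y := (hc.mem_iff y hyU).1 hy
      refine tendsto_const_nhds.congr' ?_
      filter_upwards [Ioc_mem_nhdsGT (half_pos hH)] with ε hε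
      have : cutoff H ε y = 1 := by
        refine Real.smoothTransition.one_of_one_le ?_
        rw [le_sub_iff_add_le, le_div_iff₀ hε.1]
        linarith [hε.2]
      rw [this, one_mul]
    · simp [hgU y hy hyU]

/-- A field without normal component, cut off near a boundary point, has a divergence of mean
zero. -/
lemma integral_div_bump_boundary (hc : IsBoundaryChart Ω U e L H) (ho : IsOpen Ω)
    (hb : Bornology.IsBounded Ω) (hu : UniqueDiffOn ℝ (closure Ω)) {x : Eucl D} {r : ℝ}
    (hr : 0 < r) (hxU : Metric.closedBall x (2 * r) ⊆ U) {f : Eucl D → ℝ}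
    {F : Eucl D → Eucl D} (hf : ContDiff ℝ 1 f) (hf0 : ∀ y, 0 ≤ f y)
    (hfr : tsupport f ⊆ Metric.closedBall x r) (hF : ContDiffOn ℝ 1 F (closure Ω))
    (hn : NoPenetration Ω F) : ∫ y in Ω, div Ω (fun z => f z • F z) y = 0 := by
  have hfc : HasCompactSupport f :=
    (isCompact_closedBall x r).of_isClosed_subset (isClosed_tsupport f) hfr
  have hfU : tsupport f ⊆ U :=
    hfr.trans ((Metric.closedBall_subset_closedBall (by linarith)).trans hxU)
  have hfF : ContDiffOn ℝ 1 (fun z => f z • F z) (closure Ω) := hf.contDiffOn.smul hF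
  have hT := hc.tendsto_integral_cutoff_mul ho
    (integrableOn_of_continuousOn_closure hb
      (contDiffOn_div (m := 0) hu hfF (by simp)).continuousOn)
    (fun y hy hyU => by
      have h0 : (fun z => f z • F z) =ᶠ[𝓝 y] fun _ => 0 := by
        filter_upwards [notMem_tsupport_iff_eventuallyEq.1 fun h => hyU (hfU h)] with z hz
        simp [hz]
      rw [← div_eq_of_eventuallyEq ho (G := fun _ => 0) contDiff_const hy h0.symm]
      simp)
  set C := ∫ y, |∑ i, fderiv ℝ (fun z => f z * e i) y (EuclideanSpace.single i 1)| with hC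
  have hC0 : 0 ≤ C := integral_nonneg fun y => abs_nonneg _
  have key : ∀ δ : ℝ, 0 < δ → |∫ y in Ω, div Ω (fun z => f z • F z) y| ≤ L * δ * C := by
    intro δ hδ
    obtain ⟨ρ, hρ, hρF⟩ := Metric.uniformContinuousOn_iff.1
      (hb.isCompact_closure.uniformContinuousOn_of_continuous hF.continuousOn) δ hδ
    refine le_of_tendsto hT.abs ?_
    have hm : 0 < min (ρ / 4) (r / 2) := by positivity
    filter_upwards [Ioc_mem_nhdsGT hm] with ε hε
    have hε1 : 2 * ε < ρ := by
      have := hε.2.trans (min_le_left _ _); linarith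
    have hε2 : 2 * ε ≤ r := by
      have := hε.2.trans (min_le_right _ _); linarith
    refine (hc.abs_integral_cutoff_mul_div_le ho hf hf0 hfc hfU hF hε.1 (M := L * δ)
      fun y hy hd h1 h2 => ?_).trans
      (mul_le_mul_of_nonneg_left (hc.integral_mul_cutoffDeriv_le hf hfc ε).2 (by positivity))
    have hdist : dist (y + H y • e) y = H y := by
      rw [dist_eq_norm, add_sub_cancel_left, norm_smul, hc.norm_eq, mul_one,
        Real.norm_of_nonneg (hε.1.le.trans h1)]
    have hzU : y + H y • e ∈ U := by
      refine hxU (Metric.mem_closedBall.2 ?_)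
      have := Metric.mem_closedBall.1 (hfr hy)
      linarith [dist_triangle (y + H y • e) y x]
    have hyΩ : y ∈ Ω := (hc.mem_iff y (hfU hy)).2 (hε.1.trans_le h1)
    have hz : y + H y • e ∈ frontier Ω :=
      hc.mem_frontier ho hzU (by rw [hc.vertical, sub_self])
    have h3 : fderiv ℝ H y (F y) = fderiv ℝ H y (F y - F (y + H y • e)) := by
      rw [map_sub, hc.fderiv_apply_eq_zero ho hn hd hzU, sub_zero]
    have h4 := hρF y (subset_closure hyΩ) _ hz.1 (by rw [dist_comm, hdist]; linarith)
    rw [dist_eq_norm] at h4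
    rw [h3, ← Real.norm_eq_abs]
    refine ((fderiv ℝ H y).le_opNorm _).trans ?_
    exact mul_le_mul (norm_fderiv_le_of_lipschitz ℝ hc.lipschitz) h4.le (norm_nonneg _)
      L.coe_nonneg
  have hlim : Tendsto (fun δ : ℝ => L * δ * C) (𝓝[>] 0) (𝓝 0) := by
    have : Continuous fun δ : ℝ => L * δ * C := by fun_prop
    simpa using (this.tendsto 0).mono_left nhdsWithin_le_nhds
  exact abs_nonpos_iff.1 (ge_of_tendsto hlim (by
    filter_upwards [self_mem_nhdsWithin] with δ hδ using key δ hδ))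

end IsBoundaryChart

/-- Around each point of `closure Ω` there is a bump function that localizes fields without normal
component to fields with a divergence of mean zero. -/
lemma IsLipschitzDomain.exists_bump (hΩ : IsLipschitzDomain Ω) {x : Eucl D}
    (hx : x ∈ closure Ω) : ∃ f : Eucl D → ℝ, ContDiff ℝ 1 f ∧ (∀ y, 0 ≤ f y) ∧
      (∀ᶠ y in 𝓝 x, f y = 1) ∧ ∀ F : Eucl D → Eucl D, ContDiffOn ℝ 1 F (closure Ω) →
        NoPenetration Ω F → ∫ y in Ω, div Ω (fun z => f z • F z) y = 0 := by
  by_cases hxΩ : x ∈ Ω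
  · obtain ⟨r, hr, hrΩ⟩ := Metric.nhds_basis_closedBall.mem_iff.1 (hΩ.isOpen.mem_nhds hxΩ)
    let f : ContDiffBump x := ⟨r / 2, r, half_pos hr, half_lt_self hr⟩
    refine ⟨f, f.contDiff, fun y => f.nonneg, f.eventuallyEq_one, fun F hF _ => ?_⟩
    exact integral_div_bump_interior hΩ.isOpen f.contDiff f.hasCompactSupport
      (by rw [f.tsupport_eq]; exact hrΩ) hF
  · have hxf : x ∈ frontier Ω := by rw [hΩ.isOpen.frontier_eq]; exact ⟨hx, hxΩ⟩
    obtain ⟨U, e, L, H, hxU, hc⟩ := hΩ.exists_boundaryChart hxf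
    obtain ⟨r, hr, hrU⟩ := Metric.nhds_basis_closedBall.mem_iff.1 (hc.isOpen.mem_nhds hxU)
    let f : ContDiffBump x := ⟨r / 4, r / 2, by positivity, by linarith⟩
    refine ⟨f, f.contDiff, fun y => f.nonneg, f.eventuallyEq_one, fun F hF hn => ?_⟩
    exact hc.integral_div_bump_boundary hΩ.isOpen hΩ.isBounded hΩ.uniqueDiffOn (half_pos hr)
      (by rw [mul_div_cancel₀ _ two_ne_zero]; exact hrU) f.contDiff (fun y => f.nonneg)
      (by rw [f.tsupport_eq]) hF hn

/-- The divergence theorem on a bounded Lipschitz domain, for `C^1` fields whose normal component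
vanishes wherever the normal exists. -/
theorem IsLipschitzDomain.integral_div_eq_zero (hΩ : IsLipschitzDomain Ω) {F : Eucl D → Eucl D}
    (hF : ContDiffOn ℝ 1 F (closure Ω)) (hn : NoPenetration Ω F) :
    ∫ x in Ω, div Ω F x = 0 := by
  have hu := hΩ.uniqueDiffOn
  choose! f hf hf0 hf1 hfI using fun x (hx : x ∈ closure Ω) => hΩ.exists_bump hx
  obtain ⟨t, ht, hcov⟩ := hΩ.isBounded.isCompact_closure.elim_nhds_subcover
    (fun x => {y | f x y = 1}) hf1
  -- The bump functions add up to `s ≥ 1`; localize `F / s` instead of building a partition of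
  -- unity.
  let s : Eucl D → ℝ := fun y => ∑ x ∈ t, f x y
  have hs : ContDiff ℝ 1 s := ContDiff.sum fun x hx => hf x (ht x hx)
  have hs0 : ∀ y ∈ closure Ω, s y ≠ 0 := by
    intro y hy
    obtain ⟨x, hx, hxy⟩ := mem_iUnion₂.1 (hcov hy)
    have h1 : f x y ≤ s y :=
      Finset.single_le_sum (f := fun x => f x y) (fun z hz => hf0 z (ht z hz) y) hx
    have h2 : f x y = 1 := hxy
    linarith
  have hFs : ContDiffOn ℝ 1 (fun y => (s y)⁻¹ • F y) (closure Ω) :=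
    (hs.contDiffOn.inv hs0).smul hF
  have hns : NoPenetration Ω (fun y => (s y)⁻¹ • F y) := fun x n hxn => by
    rw [inner_smul_right, hn x n hxn, mul_zero]
  have hloc : ∀ x : t, ContDiffOn ℝ 1 (fun y => f x y • (s y)⁻¹ • F y) (closure Ω) :=
    fun x => (hf x (ht x x.2)).contDiffOn.smul hFs
  have hsum : ∀ y ∈ Ω, div Ω F y = ∑ x : t, div Ω (fun y => f x y • (s y)⁻¹ • F y) y := by
    intro y hy
    rw [← div_sum hu _ hloc (subset_closure hy)]
    refine div_congr hΩ.isOpen (fun z hz => ?_) hy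
    rw [← Finset.sum_smul, Finset.sum_coe_sort t (fun x => f x z), smul_smul,
      mul_inv_cancel₀ (hs0 z (subset_closure hz)), one_smul]
  rw [setIntegral_congr_fun hΩ.isOpen.measurableSet hsum, integral_finsetSum]
  · exact Finset.sum_eq_zero fun x _ => hfI x (ht x x.2) _ hFs hns
  · exact fun x _ => integrableOn_of_continuousOn_closure hΩ.isBounded
      (contDiffOn_div (m := 0) hu (hloc x) (by simp)).continuousOn

/-! ### Integral identities -/

lemma inner_eq_sum_mul (v w : Eucl D) : (inner ℝ v w : ℝ) = ∑ i, v i * w i := by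
  simp [PiLp.inner_apply, mul_comm]

lemma IsLipschitzDomain.integrableOn (hΩ : IsLipschitzDomain Ω) {f : Eucl D → ℝ}
    (hf : ContinuousOn f (closure Ω)) : IntegrableOn f Ω :=
  integrableOn_of_continuousOn_closure hΩ.isBounded hf

lemma eqOn_closure_of_eqOn {V : Type*} [TopologicalSpace V] [T2Space V] {f g : Eucl D → V}
    (hf : ContinuousOn f (closure Ω)) (hg : ContinuousOn g (closure Ω)) (h : EqOn f g Ω) :
    EqOn f g (closure Ω) :=
  h.of_subset_closure hf hg subset_closure subset_rfl

lemma IsLipschitzDomain.eqOn_zero_of_integral_nonpos (hΩ : IsLipschitzDomain Ω)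
    {f : Eucl D → ℝ} (hf : ContinuousOn f (closure Ω)) (h0 : ∀ x, 0 ≤ f x)
    (hI : ∫ x in Ω, f x ≤ 0) : EqOn f (fun _ => 0) (closure Ω) := by
  refine eqOn_closure_of_eqOn hf continuousOn_const ?_
  have h1 : ∫ x in Ω, f x = 0 := le_antisymm hI (integral_nonneg h0)
  have h2 := (integral_eq_zero_iff_of_nonneg h0 (hΩ.integrableOn hf)).1 h1
  exact Measure.eqOn_open_of_ae_eq h2 hΩ.isOpen (hf.mono subset_closure) continuousOn_const

/-- Solenoidal fields without normal component are orthogonal to gradients. -/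
lemma IsLipschitzDomain.integral_inner_grad_eq_zero (hΩ : IsLipschitzDomain Ω)
    {v : Eucl D → Eucl D} {φ : Eucl D → ℝ} (hv : ContDiffOn ℝ 1 v (closure Ω))
    (hφ : ContDiffOn ℝ 1 φ (closure Ω)) (hs : IsSolenoidal Ω v) (hn : NoPenetration Ω v) :
    ∫ x in Ω, inner ℝ (v x) (grad Ω φ x) = 0 := by
  have h := hΩ.integral_div_eq_zero (F := fun x => φ x • v x) (hφ.smul hv)
    fun x n hxn => by rw [inner_smul_right, hn x n hxn, mul_zero]
  rw [← h]
  refine setIntegral_congr_fun hΩ.isOpen.measurableSet fun x hx => ?_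
  simp only [div_smul hΩ.uniqueDiffOn hφ hv (subset_closure hx), hs x hx, mul_zero, zero_add]

/-- The first Green identity for a function that vanishes wherever the normal exists. -/
lemma IsLipschitzDomain.integral_mul_lapl (hΩ : IsLipschitzDomain Ω) {f : Eucl D → ℝ}
    (hf : ContDiffOn ℝ 2 f (closure Ω)) (h0 : ∀ x n, IsOutwardNormal Ω x n → f x = 0) :
    ∫ x in Ω, f x * lapl Ω f x = -∫ x in Ω, ‖grad Ω f x‖ ^ 2 := by
  have hu := hΩ.uniqueDiffOn
  have hf1 : ContDiffOn ℝ 1 f (closure Ω) := hf.of_le (by norm_num)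
  have hg : ContDiffOn ℝ 1 (grad Ω f) (closure Ω) := contDiffOn_grad hu hf (by norm_num)
  have hl : ContinuousOn (lapl Ω f) (closure Ω) := by
    refine (contDiffOn_div (m := 0) hu hg (by simp)).continuousOn.congr fun x hx => ?_
    rw [div_grad hu hf hx]
  have h := hΩ.integral_div_eq_zero (F := fun x => f x • grad Ω f x) (hf1.smul hg)
    fun x n hxn => by simp [h0 x n hxn]
  have h2 : ∫ x in Ω, div Ω (fun x => f x • grad Ω f x) x =
      ∫ x in Ω, (f x * lapl Ω f x + ‖grad Ω f x‖ ^ 2) :=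
    setIntegral_congr_fun hΩ.isOpen.measurableSet fun x hx => by
      simp only [div_smul hu hf1 hg (subset_closure hx), div_grad hu hf (subset_closure hx),
        real_inner_self_eq_norm_sq]
  have hi1 : IntegrableOn (fun x => f x * lapl Ω f x) Ω :=
    hΩ.integrableOn (hf1.continuousOn.mul hl)
  have hi2 : IntegrableOn (fun x => ‖grad Ω f x‖ ^ 2) Ω :=
    hΩ.integrableOn (hg.continuousOn.norm.pow 2)
  rw [h2, integral_add hi1 hi2] at h
  linarith

lemma norm_grad_sq (f : Eucl D → ℝ) (x : Eucl D) : ‖grad Ω f x‖ ^ 2 = ∑ j, pd Ω j f x ^ 2 := by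
  rw [EuclideanSpace.real_norm_sq_eq]
  simp_rw [grad_apply]

/-- The first Green identity, componentwise, for a field that vanishes wherever the normal
exists. -/
lemma IsLipschitzDomain.integral_inner_vecLapl (hΩ : IsLipschitzDomain Ω)
    {v : Eucl D → Eucl D} (hv : ContDiffOn ℝ 2 v (closure Ω))
    (h0 : ∀ x n, IsOutwardNormal Ω x n → v x = 0) :
    ∫ x in Ω, inner ℝ (v x) (vecLapl Ω v x) = -gradNormSq Ω v := by
  have hu := hΩ.uniqueDiffOn
  have hm := hΩ.isOpen.measurableSet
  have hi : ∀ i, ContDiffOn ℝ 2 (fun y => v y i) (closure Ω) := contDiffOn_coord hv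
  have hl : ∀ i, ContinuousOn (lapl Ω fun y => v y i) (closure Ω) := fun i => by
    refine (contDiffOn_div (m := 0) hu (contDiffOn_grad (m := 1) hu (hi i) (by norm_num))
      (by simp)).continuousOn.congr fun x hx => ?_
    rw [div_grad hu (hi i) hx]
  have e1 : ∫ x in Ω, inner ℝ (v x) (vecLapl Ω v x) =
      ∫ x in Ω, ∑ i, v x i * lapl Ω (fun y => v y i) x :=
    setIntegral_congr_fun hm fun x hx => by
      simp only [inner_eq_sum_mul, vecLapl_apply hu hv (subset_closure hx),
        lapl_eq_sum_pd hu (hi _) (subset_closure hx)]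
  have hint : ∀ i, IntegrableOn (fun x => v x i * lapl Ω (fun y => v y i) x) Ω := fun i =>
    hΩ.integrableOn ((hi i).continuousOn.mul (hl i))
  have hint2 : ∀ i j, IntegrableOn (fun x => pd Ω j (fun y => v y i) x ^ 2) Ω := fun i j =>
    hΩ.integrableOn ((continuousOn_pd hu j ((hi i).of_le (by norm_num))).pow 2)
  rw [e1, integral_finsetSum _ fun i _ => hint i,
    gradNormSq, ← Finset.sum_neg_distrib]
  refine Finset.sum_congr rfl fun i _ => ?_
  rw [hΩ.integral_mul_lapl (hi i) fun x n hxn => by rw [h0 x n hxn]; rfl]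
  simp_rw [norm_grad_sq]
  rw [integral_finsetSum _ fun j _ => hint2 i j]
  congr 1
  refine Finset.sum_congr rfl fun j _ => setIntegral_congr_fun hm fun x hx => ?_
  simp only [partialDeriv_apply hu i j (hv.of_le (by norm_num)) (subset_closure hx), sq_abs]

lemma gradNormSq_congr (ho : IsOpen Ω) {v w : Eucl D → Eucl D} (h : EqOn v w Ω) :
    gradNormSq Ω v = gradNormSq Ω w := by
  refine Finset.sum_congr rfl fun i _ => Finset.sum_congr rfl fun j _ =>
    setIntegral_congr_fun ho.measurableSet fun x hx => ?_
  have : v =ᶠ[𝓝 x] w := h.eventuallyEq_of_mem (ho.mem_nhds hx)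
  simp only [partialDeriv, fderivWithin_of_mem_nhds (closure_mem_nhds_of_mem ho hx),
    this.fderiv_eq]

lemma IsLipschitzDomain.frontier_nonempty (hΩ : IsLipschitzDomain Ω) (hD : D ≠ 0) :
    (frontier Ω).Nonempty := by
  by_contra h
  have hcl : IsClopen Ω := isClopen_iff_frontier_eq_empty.2 (not_nonempty_iff_eq_empty.1 h)
  have huniv : Ω = univ := hcl.eq_univ hΩ.isConnected.nonempty
  have : Nontrivial (Eucl D) := by
    have : Nonempty (Fin D) := ⟨⟨0, Nat.pos_of_ne_zero hD⟩⟩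
    infer_instance
  exact NormedSpace.unbounded_univ ℝ (Eucl D) (huniv ▸ hΩ.isBounded)

lemma IsLipschitzDomain.eqOn_zero_of_integral_norm_grad_sq (hΩ : IsLipschitzDomain Ω) (hD : D ≠ 0)
    {f : Eucl D → ℝ} (hf : ContDiffOn ℝ 1 f (closure Ω)) (h0 : ∀ x ∈ frontier Ω, f x = 0)
    (hI : ∫ x in Ω, ‖grad Ω f x‖ ^ 2 ≤ 0) : EqOn f (fun _ => 0) (closure Ω) := by
  have hu := hΩ.uniqueDiffOn
  have hg := hΩ.eqOn_zero_of_integral_nonpos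
    ((contDiffOn_grad (m := 0) hu hf (by simp)).continuousOn.norm.pow 2)
    (fun x => sq_nonneg _) hI
  have hd : EqOn (fderiv ℝ f) 0 Ω := fun x hx => by
    have h1 : grad Ω f x = 0 := by simpa using hg (subset_closure hx)
    rw [grad, gradientWithin, fderivWithin_of_mem_nhds (closure_mem_nhds_of_mem hΩ.isOpen hx),
      LinearIsometryEquiv.map_eq_zero_iff] at h1
    exact h1
  obtain ⟨a, ha⟩ := hΩ.isOpen.exists_is_const_of_fderiv_eq_zero hΩ.isConnected.isPreconnected
    ((hf.differentiableOn one_ne_zero).mono subset_closure) hd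
  have hcl : EqOn f (fun _ => a) (closure Ω) :=
    eqOn_closure_of_eqOn hf.continuousOn continuousOn_const ha
  obtain ⟨x, hx⟩ := hΩ.frontier_nonempty hD
  have ha0 : a = 0 := (hcl hx.1).symm.trans (h0 x hx)
  exact fun y hy => (hcl hy).trans ha0

/-- The Leray projection fixes solenoidal fields without normal component. -/
lemma IsLerayProjection.eqOn (hΩ : IsLipschitzDomain Ω) {v u : Eucl D → Eucl D}
    (h : IsLerayProjection Ω v u) (hv : ContDiffOn ℝ 1 v (closure Ω))
    (hu' : ContDiffOn ℝ 1 u (closure Ω)) (hs : IsSolenoidal Ω v) (hn : NoPenetration Ω v) :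
    EqOn u v (closure Ω) := by
  have hu := hΩ.uniqueDiffOn
  obtain ⟨⟨φ, hφ, hφu⟩, hsu, hnu⟩ := h
  have hI := hΩ.integral_inner_grad_eq_zero (v := fun x => v x - u x) (hv.sub hu')
    (hφ.of_le (by norm_num))
    (fun x hx => by rw [div_sub hu hv hu' (subset_closure hx), hs x hx, hsu x hx, sub_zero])
    (fun x n hxn => by rw [inner_sub_right, hn x n hxn, hnu x n hxn, sub_zero])
  have hI2 : ∫ x in Ω, ‖grad Ω φ x‖ ^ 2 = 0 := by
    rw [← hI]
    refine setIntegral_congr_fun hΩ.isOpen.measurableSet fun x hx => ?_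
    simp only [hφu x (subset_closure hx), sub_sub_cancel, real_inner_self_eq_norm_sq]
  have hz := hΩ.eqOn_zero_of_integral_nonpos
    ((contDiffOn_grad (m := 1) hu hφ (by norm_num)).continuousOn.norm.pow 2)
    (fun x => sq_nonneg _) hI2.le
  intro x hx
  have : grad Ω φ x = 0 := by simpa using hz hx
  rw [hφu x hx, this, sub_zero]

/-! ### Algebraically stable Runge–Kutta methods -/

/-- The energy inequality of algebraically stable methods: the defect is
`k² ∑ i, ∑ j, m_{ij} f_i f_j`. -/
lemma RungeKutta.AlgebraicallyStable.sq_le {s : ℕ} {M : RungeKutta s}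
    (hM : M.AlgebraicallyStable) (k : ℝ) {y y' : ℝ} {f Y : Fin s → ℝ}
    (hy : y' = y + k * ∑ i, M.b i * f i) (hY : ∀ i, Y i = y + k * ∑ j, M.A i j * f j) :
    y' ^ 2 ≤ y ^ 2 + 2 * k * ∑ i, M.b i * (Y i * f i) := by
  have hpsd : 0 ≤ ∑ i, ∑ j, f i * ((M.b i * M.A i j + M.b j * M.A j i - M.b i * M.b j) * f j) := by
    have := hM.2.dotProduct_mulVec_nonneg f
    simpa [dotProduct, Matrix.mulVec, RungeKutta.stabilityMatrix, Finset.mul_sum] using this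
  have e1 : ∑ i, ∑ j, f i * ((M.b i * M.A i j + M.b j * M.A j i - M.b i * M.b j) * f j) =
      2 * (∑ i, ∑ j, M.b i * f i * (M.A i j * f j)) - (∑ i, M.b i * f i) ^ 2 := by
    have e2 : ∑ i, ∑ j, M.b j * f j * (M.A j i * f i) =
        ∑ i, ∑ j, M.b i * f i * (M.A i j * f j) := Finset.sum_comm
    rw [pow_two, Finset.sum_mul_sum, two_mul]
    nth_rewrite 2 [← e2]
    simp only [← Finset.sum_add_distrib, ← Finset.sum_sub_distrib]
    exact Finset.sum_congr rfl fun i _ => Finset.sum_congr rfl fun j _ => by ring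
  have e3 : ∑ i, M.b i * (Y i * f i) =
      y * (∑ i, M.b i * f i) + k * ∑ i, ∑ j, M.b i * f i * (M.A i j * f j) := by
    simp only [Finset.mul_sum, ← Finset.sum_add_distrib]
    refine Finset.sum_congr rfl fun i _ => ?_
    rw [hY, Finset.mul_sum, add_mul, mul_add, Finset.sum_mul, Finset.mul_sum]
    congr 1
    · ring
    · exact Finset.sum_congr rfl fun j _ => by ring
  rw [e1] at hpsd
  rw [e3, hy]
  nlinarith [mul_nonneg (sq_nonneg k) hpsd]

lemma RungeKutta.AlgebraicallyStable.inner_self_le {s : ℕ} {M : RungeKutta s}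
    (hM : M.AlgebraicallyStable) (k : ℝ) {y y' : Eucl D} {f Y : Fin s → Eucl D}
    (hy : y' = y + k • ∑ i, M.b i • f i) (hY : ∀ i, Y i = y + k • ∑ j, M.A i j • f j) :
    (inner ℝ y' y' : ℝ) ≤ inner ℝ y y + 2 * k * ∑ i, M.b i * inner ℝ (Y i) (f i) := by
  have h : ∀ c : Fin D, y' c ^ 2 ≤ y c ^ 2 + 2 * k * ∑ i, M.b i * (Y i c * f i c) := fun c =>
    hM.sq_le k (by rw [hy]; simp [WithLp.ofLp_sum, Finset.sum_apply])
      fun i => by rw [hY]; simp [WithLp.ofLp_sum, Finset.sum_apply]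
  have h2 := Finset.sum_le_sum fun c (_ : c ∈ Finset.univ) => h c
  rw [Finset.sum_add_distrib, ← Finset.mul_sum, Finset.sum_comm] at h2
  simp only [inner_eq_sum_mul, ← pow_two, Finset.mul_sum] at h2 ⊢
  exact h2

/-! ### The divergence and the normal component along the scheme -/

namespace IsGePUPESRK

variable {s : ℕ} {P : Params D} {M : RungeKutta s} {S : Unknowns D s}

lemma contDiffOn_explicitPart (hS : IsGePUPESRK Ω P M S) (hu : UniqueDiffOn ℝ (closure Ω))
    (n : ℕ) (i : Fin s) : ContDiffOn ℝ 1 (explicitPart Ω P M S n i) (closure Ω) :=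
  (hS.g_reg _).sub ((contDiffOn_conv hu (hS.ut_reg n i) (by norm_num)).const_smul _)

lemma contDiffOn_rho (hS : IsGePUPESRK Ω P M S) (hu : UniqueDiffOn ℝ (closure Ω))
    (n : ℕ) (i : Fin s) : ContDiffOn ℝ 1 (rho Ω P M S n i) (closure Ω) :=
  ((hS.contDiffOn_explicitPart hu n i).sub (contDiffOn_grad hu (hS.qs_reg n i) (by norm_num))).add
    ((contDiffOn_vecLapl hu (hS.ws_reg n i) (by norm_num)).const_smul _)

lemma continuousOn_combination (hS : IsGePUPESRK Ω P M S) (hu : UniqueDiffOn ℝ (closure Ω))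
    (n : ℕ) (a : Fin s → ℝ) :
    ContinuousOn (fun x => S.w n x + P.k • ∑ i, a i • rho Ω P M S n i x) (closure Ω) := by
  have h1 := (hS.w_reg n).continuousOn
  have h2 := fun i => (hS.contDiffOn_rho hu n i).continuousOn
  fun_prop

lemma w_step_closure (hS : IsGePUPESRK Ω P M S) (hu : UniqueDiffOn ℝ (closure Ω)) (n : ℕ) :
    EqOn (S.w (n + 1)) (fun x => S.w n x + P.k • ∑ i, M.b i • rho Ω P M S n i x)
      (closure Ω) :=
  eqOn_closure_of_eqOn (hS.w_reg _).continuousOn (hS.continuousOn_combination hu n _) (hS.w_step n)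

lemma ws_eq_closure (hS : IsGePUPESRK Ω P M S) (hu : UniqueDiffOn ℝ (closure Ω)) (n : ℕ)
    (i : Fin s) :
    EqOn (S.ws n i) (fun x => S.w n x + P.k • ∑ j, M.A i j • rho Ω P M S n j x)
      (closure Ω) :=
  eqOn_closure_of_eqOn (hS.ws_reg _ _).continuousOn (hS.continuousOn_combination hu n _)
    (hS.ws_eq n i)

lemma contDiffOn_div_ws (hS : IsGePUPESRK Ω P M S) (hu : UniqueDiffOn ℝ (closure Ω)) (n : ℕ)
    (i : Fin s) : ContDiffOn ℝ 2 (div Ω (S.ws n i)) (closure Ω) :=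
  contDiffOn_div hu (hS.ws_reg n i) (by norm_num)

/-- The equation for `q` turns the divergence of a stage slope into a heat term. -/
lemma div_rho (hS : IsGePUPESRK Ω P M S) (hΩ : IsLipschitzDomain Ω) (n : ℕ) (i : Fin s)
    {x : Eucl D} (hx : x ∈ Ω) :
    div Ω (rho Ω P M S n i) x = P.ν * lapl Ω (div Ω (S.ws n i)) x := by
  have hu := hΩ.uniqueDiffOn
  have hxc := subset_closure hx
  have he := hS.contDiffOn_explicitPart hu n i
  have hq : ContDiffOn ℝ 1 (grad Ω (S.qs n i)) (closure Ω) :=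
    contDiffOn_grad hu (hS.qs_reg n i) (by norm_num)
  have hl : ContDiffOn ℝ 1 (vecLapl Ω (S.ws n i)) (closure Ω) :=
    contDiffOn_vecLapl hu (hS.ws_reg n i) (by norm_num)
  have h1 : div Ω (rho Ω P M S n i) x = div Ω (explicitPart Ω P M S n i) x -
      div Ω (grad Ω (S.qs n i)) x + P.ν * div Ω (vecLapl Ω (S.ws n i)) x := by
    rw [← div_sub hu he hq hxc, ← div_const_smul hu P.ν hl hxc,
      ← div_add hu (he.sub hq) (hl.const_smul P.ν) hxc]
    rfl
  rw [h1, div_grad hu (hS.qs_reg n i) hxc, hS.q_eq n i x hx, sub_self, zero_add,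
    div_vecLapl hΩ.isOpen hu (hS.ws_reg n i) hx,
    lapl_eq_sum_pd hu (hS.contDiffOn_div_ws hu n i) hxc]

lemma div_combination (hS : IsGePUPESRK Ω P M S) (hΩ : IsLipschitzDomain Ω) (n : ℕ)
    {v : Eucl D → Eucl D} (a : Fin s → ℝ)
    (hv : ∀ x ∈ Ω, v x = S.w n x + P.k • ∑ i, a i • rho Ω P M S n i x) {x : Eucl D}
    (hx : x ∈ Ω) : div Ω v x =
      div Ω (S.w n) x + P.k * ∑ i, a i * (P.ν * lapl Ω (div Ω (S.ws n i)) x) := by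
  have hu := hΩ.uniqueDiffOn
  have hxc := subset_closure hx
  have hr := fun i => hS.contDiffOn_rho hu n i
  have hr' : ∀ i, ContDiffOn ℝ 1 (fun y => a i • rho Ω P M S n i y) (closure Ω) := fun i =>
    (hr i).const_smul _
  have hr'' : ContDiffOn ℝ 1 (fun y => ∑ i, a i • rho Ω P M S n i y) (closure Ω) :=
    ContDiffOn.sum fun i _ => hr' i
  rw [div_congr hΩ.isOpen hv hx, div_add hu (hS.w_reg n) (hr''.const_smul P.k) hxc,
    div_const_smul hu P.k hr'' hxc, div_sum hu _ hr' hxc]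
  simp_rw [fun i => div_const_smul hu (a i) (hr i) hxc, fun i => hS.div_rho hΩ n i hx]

/-- The pressure boundary condition damps the normal component of the stage slopes. -/
lemma inner_normal_rho (hS : IsGePUPESRK Ω P M S) (n : ℕ) (i : Fin s) {x nrm : Eucl D}
    (hx : IsOutwardNormal Ω x nrm) :
    inner ℝ nrm (rho Ω P M S n i x) = -P.pen * inner ℝ nrm (S.ws n i x) := by
  have h := hS.q_bdry n i x nrm hx
  rw [rho, inner_add_right, inner_sub_right, h, inner_add_right]
  ring

/-- If `w^n` is solenoidal, so are `w^{n+1}` and the stages with positive weight: the divergence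
follows the Runge–Kutta method for the heat equation with zero boundary values. -/
lemma isSolenoidal_succ (hS : IsGePUPESRK Ω P M S) (hΩ : IsLipschitzDomain Ω)
    (hM : M.AlgebraicallyStable) {n : ℕ} (hn : IsSolenoidal Ω (S.w n)) :
    IsSolenoidal Ω (S.w (n + 1)) ∧ ∀ i, 0 < M.b i → IsSolenoidal Ω (S.ws n i) := by
  rcases eq_or_ne D 0 with rfl | hD
  -- In dimension zero the boundary is empty, but the divergence is an empty sum.
  · exact ⟨fun x _ => by simp [div], fun i _ x _ => by simp [div]⟩
  have hu := hΩ.uniqueDiffOn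
  have hm := hΩ.isOpen.measurableSet
  set d := fun i => div Ω (S.ws n i) with hd_def
  have hd : ∀ i, ContDiffOn ℝ 2 (d i) (closure Ω) := hS.contDiffOn_div_ws hu n
  have hd' : ContinuousOn (div Ω (S.w (n + 1))) (closure Ω) :=
    (contDiffOn_div (m := 0) hu (hS.w_reg _) (by simp)).continuousOn
  have hpt : ∀ x ∈ Ω, div Ω (S.w (n + 1)) x ^ 2 ≤
      ∑ i, 2 * P.k * P.ν * M.b i * (d i x * lapl Ω (d i) x) := fun x hx => by
    have h := hM.sq_le P.k (hS.div_combination hΩ n M.b (hS.w_step n) hx)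
      (fun i => hS.div_combination hΩ n (M.A i) (hS.ws_eq n i) hx)
    rw [hn x hx, zero_pow two_ne_zero, zero_add, Finset.mul_sum] at h
    exact h.trans_eq (Finset.sum_congr rfl fun i _ => by ring)
  have hint : ∀ i, IntegrableOn (fun x => 2 * P.k * P.ν * M.b i * (d i x * lapl Ω (d i) x)) Ω := by
    intro i
    refine hΩ.integrableOn (continuousOn_const.mul ((hd i).continuousOn.mul ?_))
    refine (contDiffOn_div (m := 0) hu (contDiffOn_grad (m := 1) hu (hd i) (by norm_num))
      (by simp)).continuousOn.congr fun x hx => ?_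
    rw [div_grad hu (hd i) hx]
  have hI := setIntegral_mono_on (hΩ.integrableOn (hd'.pow 2))
    (integrable_finsetSum _ fun i _ => hint i) hm hpt
  rw [integral_finsetSum _ fun i _ => hint i] at hI
  have hGreen : ∀ i, ∫ x in Ω, 2 * P.k * P.ν * M.b i * (d i x * lapl Ω (d i) x) =
      -(2 * P.k * P.ν * (M.b i * ∫ x in Ω, ‖grad Ω (d i) x‖ ^ 2)) := fun i => by
    rw [integral_const_mul, hΩ.integral_mul_lapl (hd i) fun x nrm hx =>
      hS.ws_div_bdry n i x hx.1]
    ring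
  simp_rw [hGreen] at hI
  rw [Finset.sum_neg_distrib, ← Finset.mul_sum] at hI
  have hterm : ∀ i, 0 ≤ M.b i * ∫ x in Ω, ‖grad Ω (d i) x‖ ^ 2 := fun i =>
    mul_nonneg (hM.1 i) (integral_nonneg fun x => sq_nonneg _)
  have hsum : 0 ≤ ∑ i, M.b i * ∫ x in Ω, ‖grad Ω (d i) x‖ ^ 2 :=
    Finset.sum_nonneg fun i _ => hterm i
  have hkν : 0 < 2 * P.k * P.ν := mul_pos (mul_pos two_pos P.k_pos) P.ν_pos
  have hprod := mul_nonneg hkν.le hsum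
  have hlhs : 0 ≤ ∫ x in Ω, div Ω (S.w (n + 1)) x ^ 2 := integral_nonneg fun x => sq_nonneg _
  constructor
  · intro x hx
    have := hΩ.eqOn_zero_of_integral_nonpos (hd'.pow 2) (fun x => sq_nonneg _)
      (hI.trans (by linarith)) (subset_closure hx)
    simpa using this
  · intro i hi x hx
    have hle : ∑ i, M.b i * ∫ x in Ω, ‖grad Ω (d i) x‖ ^ 2 ≤ 0 := by
      by_contra! h
      have hI' : ∫ x in Ω, div Ω (S.w (n + 1)) x ^ 2 ≤ _ := hI
      linarith [mul_pos hkν h]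
    have h1 := (Finset.single_le_sum (fun j _ => hterm j) (Finset.mem_univ i)).trans hle
    have h2 : ∫ x in Ω, ‖grad Ω (d i) x‖ ^ 2 ≤ 0 := nonpos_of_mul_nonpos_right h1 hi
    exact hΩ.eqOn_zero_of_integral_norm_grad_sq hD ((hd i).of_le (by norm_num))
      (hS.ws_div_bdry n i) h2 (subset_closure hx)

/-- If `w^n` has no normal component, neither have `w^{n+1}` and the stages with positive weight:
the normal component follows the Runge–Kutta method for `z' = -λ z`. -/
lemma noPenetration_succ (hS : IsGePUPESRK Ω P M S) (hΩ : IsLipschitzDomain Ω)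
    (hM : M.AlgebraicallyStable) {n : ℕ} (hn : NoPenetration Ω (S.w n)) :
    NoPenetration Ω (S.w (n + 1)) ∧ ∀ i, 0 < M.b i → NoPenetration Ω (S.ws n i) := by
  have hu := hΩ.uniqueDiffOn
  have hlin : ∀ (a : Fin s → ℝ) (v : Eucl D → Eucl D),
      EqOn v (fun x => S.w n x + P.k • ∑ i, a i • rho Ω P M S n i x) (closure Ω) →
      ∀ x nrm, IsOutwardNormal Ω x nrm → inner ℝ nrm (v x) =
        0 + P.k * ∑ i, a i * (-P.pen * inner ℝ nrm (S.ws n i x)) := by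
    intro a v hv x nrm hx
    rw [hv hx.1.1]
    simp only [inner_add_right, hn x nrm hx, inner_smul_right, inner_sum,
      hS.inner_normal_rho n _ hx]
  have hineq : ∀ x nrm, IsOutwardNormal Ω x nrm → (inner ℝ nrm (S.w (n + 1) x) : ℝ) ^ 2 ≤
      -(2 * P.k * P.pen * ∑ i, M.b i * (inner ℝ nrm (S.ws n i x) : ℝ) ^ 2) := by
    intro x nrm hx
    have h := hM.sq_le P.k (hlin M.b _ (hS.w_step_closure hu n) x nrm hx)
      (fun i => hlin (M.A i) _ (hS.ws_eq_closure hu n i) x nrm hx)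
    rw [zero_pow two_ne_zero, zero_add] at h
    refine h.trans_eq ?_
    rw [Finset.mul_sum, Finset.mul_sum, ← Finset.sum_neg_distrib]
    exact Finset.sum_congr rfl fun i _ => by ring
  have hterm : ∀ (x nrm : Eucl D) (i : Fin s),
      0 ≤ M.b i * (inner ℝ nrm (S.ws n i x) : ℝ) ^ 2 := fun x nrm i =>
    mul_nonneg (hM.1 i) (sq_nonneg _)
  have hsum : ∀ x nrm : Eucl D, 0 ≤ ∑ i, M.b i * (inner ℝ nrm (S.ws n i x) : ℝ) ^ 2 :=
    fun x nrm => Finset.sum_nonneg fun i _ => hterm x nrm i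
  have hkp : 0 ≤ 2 * P.k * P.pen := mul_nonneg (mul_nonneg two_pos.le P.k_pos.le) P.pen_nonneg
  constructor
  · intro x nrm hx
    have h := hineq x nrm hx
    have := mul_nonneg hkp (hsum x nrm)
    exact pow_eq_zero_iff two_ne_zero |>.1 (le_antisymm (by linarith) (sq_nonneg _))
  · intro i hi x nrm hx
    -- For `λ = 0` there is no dissipation, but then the normal component does not change at all.
    rcases P.pen_nonneg.eq_or_lt with hp | hp
    · rw [hlin (M.A i) _ (hS.ws_eq_closure hu n i) x nrm hx]
      simp [← hp]
    · have hkp' : 0 < 2 * P.k * P.pen := mul_pos (mul_pos two_pos P.k_pos) hp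
      have hle : ∑ i, M.b i * (inner ℝ nrm (S.ws n i x) : ℝ) ^ 2 ≤ 0 := by
        by_contra! h
        have := mul_pos hkp' h
        have := hineq x nrm hx
        have := sq_nonneg (inner ℝ nrm (S.w (n + 1) x) : ℝ)
        linarith
      have h1 := (Finset.single_le_sum (fun j _ => hterm x nrm j) (Finset.mem_univ i)).trans hle
      have h2 : (inner ℝ nrm (S.ws n i x) : ℝ) ^ 2 ≤ 0 := nonpos_of_mul_nonpos_right h1 hi
      exact pow_eq_zero_iff two_ne_zero |>.1 (le_antisymm h2 (sq_nonneg _))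

lemma isSolenoidal_and_noPenetration (hS : IsGePUPESRK Ω P M S) (hΩ : IsLipschitzDomain Ω)
    (hM : M.AlgebraicallyStable) (h0 : InitialCondition Ω S) (n : ℕ) :
    IsSolenoidal Ω (S.w n) ∧ NoPenetration Ω (S.w n) := by
  induction n with
  | zero =>
    refine ⟨fun x hx => ?_, fun x nrm hx => ?_⟩
    · rw [div_congr hΩ.isOpen (fun y hy => h0.1 y (subset_closure hy)) hx, h0.2.1 x hx]
    · rw [h0.1 x hx.1.1, h0.2.2 x nrm hx]
  | succ n ih =>
    exact ⟨(hS.isSolenoidal_succ hΩ hM ih.1).1, (hS.noPenetration_succ hΩ hM ih.2).1⟩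

lemma u_eqOn_w (hS : IsGePUPESRK Ω P M S) (hΩ : IsLipschitzDomain Ω)
    (hM : M.AlgebraicallyStable) (h0 : InitialCondition Ω S) (n : ℕ) :
    EqOn (S.u n) (S.w n) (closure Ω) := by
  cases n with
  | zero => exact fun x hx => (h0.1 x hx).symm
  | succ n =>
    obtain ⟨h1, h2⟩ := hS.isSolenoidal_and_noPenetration hΩ hM h0 (n + 1)
    exact (hS.u_step n).eqOn hΩ (hS.w_reg _) (hS.u_reg _) h1 h2

/-! ### The energy balance -/

/-- The power of a stage slope: conservative forces and the pressure do no work, the convection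
term is the one that drives `r`, and the viscous term dissipates. -/
lemma integral_inner_ws_rho (hS : IsGePUPESRK Ω P M S) (hΩ : IsLipschitzDomain Ω)
    (hg : IsConservative Ω P.g) {n : ℕ} {i : Fin s} (hs : IsSolenoidal Ω (S.ws n i))
    (hn : NoPenetration Ω (S.ws n i)) :
    ∫ x in Ω, inner ℝ (S.ws n i x) (rho Ω P M S n i x) =
      -(S.rs n i * Icv Ω (S.ut n i) (S.us n i)) - P.ν * gradNormSq Ω (S.us n i) := by
  have hu := hΩ.uniqueDiffOn
  have hm := hΩ.isOpen.measurableSet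
  have hw1 : ContDiffOn ℝ 1 (S.ws n i) (closure Ω) := (hS.ws_reg n i).of_le (by norm_num)
  have hw2 : ContDiffOn ℝ 2 (S.ws n i) (closure Ω) := (hS.ws_reg n i).of_le (by norm_num)
  have husw : EqOn (S.us n i) (S.ws n i) (closure Ω) :=
    (hS.us_eq n i).eqOn hΩ hw1 (hS.us_reg n i) hs hn
  have hws0 : ∀ x nrm, IsOutwardNormal Ω x nrm → S.ws n i x = 0 := by
    intro x nrm hx
    -- Without normal component, `w` is itself a tangent vector, hence orthogonal to itself.
    have := hS.ws_tangential n i x nrm hx (S.ws n i x) (by rw [real_inner_comm, hn x nrm hx])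
    exact inner_self_eq_zero.1 this
  obtain ⟨φ, hφ, hgφ⟩ := hg (P.t₀ + n * P.k + M.c i * P.k)
  have hcv : ContDiffOn ℝ 1 (conv Ω (S.ut n i)) (closure Ω) :=
    contDiffOn_conv hu (hS.ut_reg n i) (by norm_num)
  have hgr : ContDiffOn ℝ 1 (grad Ω (S.qs n i)) (closure Ω) :=
    contDiffOn_grad hu (hS.qs_reg n i) (by norm_num)
  have hgφc : ContDiffOn ℝ 0 (grad Ω φ) (closure Ω) := contDiffOn_grad hu hφ (by simp)
  have hvl : ContDiffOn ℝ 1 (vecLapl Ω (S.ws n i)) (closure Ω) :=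
    contDiffOn_vecLapl hu (hS.ws_reg n i) (by norm_num)
  have hint : ∀ {v : Eucl D → Eucl D}, ContinuousOn v (closure Ω) →
      IntegrableOn (fun x => (inner ℝ (S.ws n i x) (v x) : ℝ)) Ω := fun hv =>
    hΩ.integrableOn (hw1.continuousOn.inner hv)
  have i1 := hint hgφc.continuousOn
  have i2 := (hint hcv.continuousOn).const_mul (S.rs n i)
  have i3 := hint hgr.continuousOn
  have i4 := (hint hvl.continuousOn).const_mul P.ν
  have e : ∫ x in Ω, inner ℝ (S.ws n i x) (rho Ω P M S n i x) =
      ∫ x in Ω, (-(inner ℝ (S.ws n i x) (grad Ω φ x)) -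
        S.rs n i * inner ℝ (S.ws n i x) (conv Ω (S.ut n i) x) -
        inner ℝ (S.ws n i x) (grad Ω (S.qs n i) x) +
        P.ν * inner ℝ (S.ws n i x) (vecLapl Ω (S.ws n i) x)) :=
    setIntegral_congr_fun hm fun x hx => by
      simp only [rho, explicitPart, stageForce, hgφ x hx, inner_add_right, inner_sub_right,
        inner_neg_right, inner_smul_right]
  have hI : ∫ x in Ω, inner ℝ (S.ws n i x) (conv Ω (S.ut n i) x) =
      Icv Ω (S.ut n i) (S.us n i) :=
    setIntegral_congr_fun hm fun x hx => by
      simp only [husw (subset_closure hx), real_inner_comm]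
  have i12 := i1.fun_neg.fun_sub i2
  rw [e, integral_add (i12.fun_sub i3) i4, integral_sub i12 i3,
    integral_sub i1.fun_neg i2, integral_neg, integral_const_mul, integral_const_mul,
    hΩ.integral_inner_grad_eq_zero hw1 hφ hs hn,
    hΩ.integral_inner_grad_eq_zero hw1 ((hS.qs_reg n i).of_le (by norm_num)) hs hn,
    hΩ.integral_inner_vecLapl hw2 hws0, hI,
    gradNormSq_congr hΩ.isOpen (husw.mono subset_closure)]
  ring

end IsGePUPESRK

lemma energy_eq {s : ℕ} (S : Unknowns D s) (n : ℕ) :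
    energy Ω S n = (1 / 2) * (l2Inner Ω (S.u n) (S.u n) + S.r n ^ 2) := by
  rw [energy, l2Norm, Real.sq_sqrt, sq_abs]
  exact integral_nonneg fun x => real_inner_self_nonneg

end

end GePUP

theorem mainTheorem1 {D s : ℕ} (Ω : Set (GePUP.Eucl D)) (hΩ : GePUP.IsLipschitzDomain Ω)
    (P : GePUP.Params D) (M : GePUP.RungeKutta s) (S : GePUP.Unknowns D s)
    (hg : GePUP.IsConservative Ω P.g)
    (hM : M.AlgebraicallyStable)
    (hS : GePUP.IsGePUPESRK Ω P M S)
    (h0 : GePUP.InitialCondition Ω S) :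
    ∀ n : ℕ, GePUP.energy Ω S (n + 1) - GePUP.energy Ω S n ≤
      -(P.k * P.ν) * ∑ i, M.b i * GePUP.gradNormSq Ω (S.us n i) := by
  intro n
  have hm := hΩ.isOpen.measurableSet
  have hu := hΩ.uniqueDiffOn
  obtain ⟨hsn, hnn⟩ := hS.isSolenoidal_and_noPenetration hΩ hM h0 n
  have hl2 : ∀ m, GePUP.l2Inner Ω (S.u m) (S.u m) = ∫ x in Ω, inner ℝ (S.w m x) (S.w m x) :=
    fun m => setIntegral_congr_fun hm fun x hx => by
      simp only [hS.u_eqOn_w hΩ hM h0 m (subset_closure hx)]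
  have hww : ∀ m, IntegrableOn (fun x => (inner ℝ (S.w m x) (S.w m x) : ℝ)) Ω := fun m =>
    hΩ.integrableOn ((hS.w_reg m).continuousOn.inner (hS.w_reg m).continuousOn)
  have hwr : ∀ i, IntegrableOn
      (fun x => M.b i * (inner ℝ (S.ws n i x) (GePUP.rho Ω P M S n i x) : ℝ)) Ω := fun i =>
    (hΩ.integrableOn ((hS.ws_reg n i).continuousOn.inner
      (hS.contDiffOn_rho hu n i).continuousOn)).const_mul _
  have hsum : IntegrableOn (fun x => 2 * P.k * ∑ i, M.b i *
      (inner ℝ (S.ws n i x) (GePUP.rho Ω P M S n i x) : ℝ)) Ω :=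
    (integrable_finsetSum _ fun i _ => hwr i).const_mul _
  have hI := setIntegral_mono_on (hww (n + 1)) ((hww n).add hsum) hm fun x hx =>
    hM.inner_self_le P.k (hS.w_step n x hx) fun i => hS.ws_eq n i x hx
  have hI2 := integral_add (hww n) hsum
  rw [integral_const_mul, integral_finsetSum _ fun i _ => hwr i] at hI2
  simp only [integral_const_mul] at hI2
  have hstage : ∀ i, M.b i * ∫ x in Ω, (inner ℝ (S.ws n i x) (GePUP.rho Ω P M S n i x) : ℝ) =
      -(M.b i * (S.rs n i * GePUP.Icv Ω (S.ut n i) (S.us n i))) -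
        P.ν * (M.b i * GePUP.gradNormSq Ω (S.us n i)) := by
    intro i
    -- Only the stages with positive weight are known to be solenoidal; the others drop out.
    rcases (hM.1 i).eq_or_lt with hi | hi
    · simp [← hi]
    rw [hS.integral_inner_ws_rho hΩ hg ((hS.isSolenoidal_succ hΩ hM hsn).2 i hi)
      ((hS.noPenetration_succ hΩ hM hnn).2 i hi)]
    ring
  simp only [hstage, Finset.sum_sub_distrib, Finset.sum_neg_distrib, ← Finset.mul_sum] at hI2
  have hr := hM.sq_le P.k (hS.r_step n) (hS.rs_eq n)
  rw [GePUP.energy_eq, GePUP.energy_eq, hl2, hl2]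
  have hI' := hI.trans_eq hI2
  nlinarith [hI', hr]
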